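/- A path is a continuous function from a closed interval to $\mathbb{C}$. For $x,t\in[0,1]$, $\mu\in(0,1]$ and $j\in\mathbb{Z}$ let $S_j^{x,t,\mu}=\mu e^{t\pi i}\left(\{z\in\mathbb{C}: j\le \operatorname{Im} z\le j+1\}+ix\right)$, and for $A\subset\mathbb{C}$ let $\|A\|_t$ be the diameter of the orthogonal projection of $A$ onto the line $\{re^{(t+\frac12)\pi i}:r\in\mathbb{R}\}$. For a path $\gamma$ let $C_0,C_1,\dots$ (a finite or infinite list) enumerate the components $C$ of the sets $\gamma^{-1}(S_j^{x,t,\mu})$, $j\in\mathbb{Z}$, with $\|\gamma(C)\|_t>0$, so that $\|\gamma(C_n)\|_t$ is nonincreasing in $n$, and put $$L^{x,t,\mu}(\gamma)=\sum_{n}\frac{\|\gamma(C_n)\|_t}{2^n},\qquad \operatorname{len}(\gamma)=\int_0^1\!\int_0^1\!\int_0^1 L^{x,t,\mu}(\gamma)\,dx\,dt\,d\mu .$$ For a path $\gamma:[0,1]\to\mathbb{C}$, the standard representation of $\gamma$, rescaled to $[0,1]$, is the path $\tilde\gamma:[0,1]\to\mathbb{C}$ with $\tilde\gamma(s)=\gamma(\tau)$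 whenever $\tau\in[0,1]$ satisfies $\operatorname{len}(\gamma|_{[0,\tau]})=s\cdot\operatorname{len}(\gamma)$. **Theorem.** For every path $\gamma:[0,1]\to\mathbb{C}$ the standard representation is well defined: for each $s\in[0,1]$ such a $\tau$ exists, $\gamma(\tau)$ does not depend on its choice, and $\tilde\gamma$ is continuous. Let $\mathcal{F}$ be a family of paths $[0,1]\to\mathbb{C}$, and consider the property $(\dagger)$ for each $\varepsilon>0$ there is a positive integer $N$ such that for every $\gamma\in\mathcal{F}$ there is no collection of more than $N$ pairwise disjoint subintervals of $[0,1]$ whose images under $\gamma$ have diameters $\ge\varepsilon$. If $\mathcal{F}$ satisfies $(\dagger)$, then the family $\tilde{\mathcal{F}}=\{\tilde\gamma:\gamma\in\mathcal{F}\}$ is equicontinuous. Moreover, in that case, if $K\subset\mathbb{C}$ is compact and $\gamma([0,1])\subseteq K$ for every $\gamma\in\mathcal{F}$, then every sequence $(\tilde\gamma_m)_{m\ge0}$ in $\tilde{\mathcal{F}}$ has a subsequence which converges uniformly to a path $\tilde\gamma_\infty:[0,1]\to K$, and $\tilde\gamma_\infty$ is its own standard representation (rescaled to $[0,1]$). Conversely,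 if $\mathcal{F}$ is an equicontinuous family of paths, then $\mathcal{F}$ satisfies $(\dagger)$. -/

import Mathlib

open Set MeasureTheory Filter
open scoped ENNReal

noncomputable section

namespace PathLength

/-- The closed strip `μ e^{tπi} (S_j + i x)`, where `S_j = {z : j ≤ Im z ≤ j + 1}`. -/
def strip (x t μ : ℝ) (j : ℤ) : Set ℂ :=
  (fun z : ℂ => (μ : ℂ) * Complex.exp (t * Real.pi * Complex.I) * (z + Complex.I * x)) ''
    {z : ℂ | (j : ℝ) ≤ z.im ∧ z.im ≤ (j : ℝ) + 1}

/-- Orthogonal projection of the plane onto the line `{r e^{(t + 1/2)πi} : r ∈ ℝ}`. -/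
def perpProj (t : ℝ) : ℂ →L[ℝ] ℂ :=
  (Submodule.span ℝ {Complex.exp ((t + 1 / 2) * Real.pi * Complex.I)}).starProjection

/-- `‖A‖_t`, the Euclidean diameter of the projection of `A`. -/
def perpWidth (t : ℝ) (A : Set ℂ) : ℝ≥0∞ := Metric.ediam (perpProj t '' A)

variable {X : Type*} [TopologicalSpace X]

/-- All components, with non-degenerate image under `perpProj t ∘ γ`, of the preimages of the
strips `strip x t μ j` (`j : ℤ`) under the restriction of `γ` to `A`. -/
def stripComponents (γ : X → ℂ) (A : Set X) (x t μ : ℝ) : Set (Set X) :=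
  {C | (∃ j : ℤ, ∃ p ∈ A ∩ γ ⁻¹' strip x t μ j,
      C = connectedComponentIn (A ∩ γ ⁻¹' strip x t μ j) p) ∧
    (perpProj t '' (γ '' C)).Nontrivial}

/-- The `n`-th (starting from `0`) term when the numbers `‖γ(C)‖_t`, for `C` ranging over
`stripComponents γ A x t μ`, are listed in nonincreasing order with multiplicity; it is `0` if there
are at most `n` such components. It is the largest `r` such that more than `n` of the
components `C` have `‖γ(C)‖_t ≥ r`. -/
def sortedWidth (γ : X → ℂ) (A : Set X) (x t μ : ℝ) (n : ℕ) : ℝ≥0∞ :=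
  ⨆ (r : ℝ≥0∞)
    (_ : (n : ℕ∞) < {C ∈ stripComponents γ A x t μ | r ≤ perpWidth t (γ '' C)}.encard), r

/-- `L^{x,t,μ}` of the restriction of `γ` to `A`. -/
def stripLength (γ : X → ℂ) (A : Set X) (x t μ : ℝ) : ℝ≥0∞ :=
  ∑' n : ℕ, sortedWidth γ A x t μ n / 2 ^ n

/-- The length `len(γ|_A)` of the restriction of `γ` to `A`. -/
def len (γ : X → ℂ) (A : Set X) : ℝ :=
  (∫⁻ μ in Ioc (0 : ℝ) 1, ∫⁻ t in Icc (0 : ℝ) 1, ∫⁻ x in Icc (0 : ℝ) 1,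
    stripLength γ A x t μ).toReal

/-- `g` is the standard representation of the path `γ`, with domain linearly rescaled from
`[0, len γ]` to `[0, 1]`: for each `s` there is a `t` with `len(γ|_[0,t]) = s * len γ`, and
`g s = γ t` for every such `t`. -/
def IsStandardRep (γ g : C(unitInterval, ℂ)) : Prop :=
  ∀ s : unitInterval,
    (∃ t : unitInterval, len γ (Iic t) = s * len γ univ) ∧
    ∀ t : unitInterval, len γ (Iic t) = s * len γ univ → g s = γ t

/-- The family of the (rescaled) standard representations of the members of `F`. -/
def standardReps (F : Set C(unitInterval, ℂ)) : Set C(unitInterval, ℂ) :=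
  {g | ∃ γ ∈ F, IsStandardRep γ g}

/-- For each `ε > 0` there is a positive integer `N` such that, for every path of the family, there
are no more than `N` pairwise disjoint subintervals of `[0, 1]` with images of diameter `≥ ε`. -/
def FewLongSections (F : Set C(unitInterval, ℂ)) : Prop :=
  ∀ ε : ℝ, 0 < ε → ∃ N : ℕ, 0 < N ∧ ∀ γ ∈ F, ∀ 𝒥 : Set (Set unitInterval),
    𝒥.PairwiseDisjoint id →
    (∀ J ∈ 𝒥, J.OrdConnected ∧ ε ≤ Metric.diam (γ '' J)) →
    𝒥.encard ≤ N

end PathLength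

end

open scoped Topology unitInterval NNReal

/-! The length is robust because the components can be replaced by finite witnesses. After rotation
and division by `μ`, the strips become the unit bands between consecutive integers. More than `n`
components of width about `r` amount to `n + 1` parameter intervals, each mapped into one band with
end values about `r` apart, two intervals of the same band being separated by a point outside it
(`sortedWidth_eq`). Such witnesses are insensitive to monotone reparametrization.

Continuity: the witnesses are stable under uniform perturbation in both directions unless a band
boundary is a local extremum value of the transverse coordinate. These values are countable, so this
happens only for a null set of offsets `x`. Dominated convergence makes the length continuous in the
path for the uniform topology (`continuous_totalLength`).

Growth: suppose `γ a` and `γ b` are `ε` apart. For a definite proportion of directions and all `μ`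
in a fixed interval of small values, a new strip is fully crossed between `a` and `b`. Its maximal
width heads the ordered list and pushes the earlier widths down one place. Under `(†)` only
boundedly many of these were large, so the weighted sum gains a fixed amount
(`FewLongSections.exists_gap`).

Applied to a single path, the gap shows that equal lengths give equal points. Applied to a family,
it bounds the modulus of continuity of the standard representations, and Arzelà–Ascoli gives limits.
Proportionality of length to parameter survives the limit by continuity of the length. -/

namespace PathLength

/-! ### Sections: finite witnesses for strip components -/

/-- On `[0, t]` there are `n + 1` closed intervals, each mapped by `f` into a strip `[j, j + 1]` with
end values at distance at least `r`, such that two intervals belonging to the same strip are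
separated by a point at which `f` is outside that strip. -/
def HasSections (t : I) (n : ℕ) (r : ℝ) (f : I → ℝ) : Prop :=
  ∃ (j : Fin (n + 1) → ℤ) (u v : Fin (n + 1) → I),
    (∀ i, u i ≤ v i ∧ v i ≤ t ∧ (∀ s, u i ≤ s → s ≤ v i → f s ∈ Icc (j i : ℝ) (j i + 1)) ∧
      r ≤ |f (u i) - f (v i)|) ∧
    ∀ i k, i ≠ k → j i = j k →
      ∃ w, (v i < w ∧ w < u k ∨ v k < w ∧ w < u i) ∧ f w ∉ Icc (j i : ℝ) (j i + 1)

lemma HasSections.mono {t t' : I} {n n' : ℕ} {r r' : ℝ} {f : I → ℝ} (h : HasSections t n r f)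
    (ht : t ≤ t') (hn : n' ≤ n) (hr : r' ≤ r) : HasSections t' n' r' f := by
  obtain ⟨j, u, v, h₁, h₂⟩ := h
  have hn' : n' + 1 ≤ n + 1 := by omega
  refine ⟨j ∘ Fin.castLE hn', u ∘ Fin.castLE hn', v ∘ Fin.castLE hn', fun i => ?_,
    fun i k hik hj => ?_⟩
  · obtain ⟨a, b, c, d⟩ := h₁ (Fin.castLE hn' i)
    exact ⟨a, b.trans ht, c, hr.trans d⟩
  · exact h₂ _ _ (fun h => hik (Fin.castLE_injective hn' h)) hj

lemma HasSections.le_one {t : I} {n : ℕ} {r : ℝ} {f : I → ℝ} (h : HasSections t n r f) : r ≤ 1 := by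
  obtain ⟨j, u, v, h₁, -⟩ := h
  obtain ⟨a, -, c, d⟩ := h₁ 0
  have hu := c (u 0) le_rfl a
  have hv := c (v 0) a le_rfl
  refine d.trans (abs_le.2 ⟨?_, ?_⟩) <;> linarith [hu.1, hu.2, hv.1, hv.2]

lemma not_hasSections_zero {n : ℕ} {r : ℝ} {f : I → ℝ} (hr : 0 < r) : ¬ HasSections 0 n r f := by
  rintro ⟨j, u, v, h₁, -⟩
  obtain ⟨a, b, -, d⟩ := h₁ 0
  have hv : v 0 = 0 := le_antisymm b unitInterval.nonneg'
  have hu : u 0 = 0 := le_antisymm (a.trans b) unitInterval.nonneg'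
  rw [hu, hv, sub_self, abs_zero] at d
  exact hr.not_ge d

/-- The intervals of a family of sections can be pushed forward under, and pulled back along, a
continuous monotone change of the parameter. -/
lemma hasSections_comp {l : I → I} (hl : Monotone l) (hc : Continuous l) (h0 : l 0 = 0) {t : I}
    {n : ℕ} {r : ℝ} {f : I → ℝ} :
    HasSections t n r (f ∘ l) ↔ HasSections (l t) n r f := by
  have surj : ∀ {a b c : I}, a ≤ b → l a ≤ c → c ≤ l b → ∃ s, a ≤ s ∧ s ≤ b ∧ l s = c := by
    intro a b c hab h₁ h₂
    obtain ⟨s, hs, h⟩ := intermediate_value_Icc hab hc.continuousOn ⟨h₁, h₂⟩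
    exact ⟨s, hs.1, hs.2, h⟩
  constructor
  · rintro ⟨j, u, v, h₁, h₂⟩
    refine ⟨j, l ∘ u, l ∘ v, fun i => ?_, fun i k hik hj => ?_⟩
    · obtain ⟨a, b, c, d⟩ := h₁ i
      refine ⟨hl a, hl b, fun s hs hs' => ?_, d⟩
      obtain ⟨p, hp, hp', rfl⟩ := surj a hs hs'
      exact c p hp hp'
    · obtain ⟨w, hw, hw'⟩ := h₂ i k hik hj
      -- Since `l` may collapse intervals, strict inequalities survive only because the separating
      -- point has a value outside the strip, while the section endpoints have values inside.
      have key : ∀ a, f (l a) ∈ Icc (j i : ℝ) (j i + 1) → l w ≠ l a := fun a ha h => by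
        rw [Function.comp_apply, h] at hw'; exact hw' ha
      refine ⟨l w, ?_, hw'⟩
      obtain ⟨a, b, c, d⟩ := h₁ i
      obtain ⟨a', b', c', d'⟩ := h₁ k
      rw [← hj] at c'
      refine hw.imp (fun h => ⟨(hl h.1.le).lt_of_ne ?_, (hl h.2.le).lt_of_ne ?_⟩)
        (fun h => ⟨(hl h.1.le).lt_of_ne ?_, (hl h.2.le).lt_of_ne ?_⟩)
      · exact (key _ (c _ a le_rfl)).symm
      · exact key _ (c' _ le_rfl a')
      · exact (key _ (c' _ a' le_rfl)).symm
      · exact key _ (c _ le_rfl a)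
  · rintro ⟨j, u, v, h₁, h₂⟩
    -- Right endpoints are lifted first, below `t`; left endpoints are then lifted below them, which
    -- keeps the order.
    have hv : ∀ i, ∃ s, s ≤ t ∧ l s = v i := fun i => by
      obtain ⟨s, -, hs, h⟩ := surj (unitInterval.nonneg' (t := t))
        (h0.le.trans unitInterval.nonneg') (h₁ i).2.1
      exact ⟨s, hs, h⟩
    choose v' hvt hv' using hv
    have hu : ∀ i, ∃ s, s ≤ v' i ∧ l s = u i := fun i => by
      obtain ⟨s, -, hs, h⟩ := surj (unitInterval.nonneg' (t := v' i))
        (h0.le.trans unitInterval.nonneg') (hv' i ▸ (h₁ i).1)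
      exact ⟨s, hs, h⟩
    choose u' hut hu' using hu
    refine ⟨j, u', v', fun i => ?_, fun i k hik hj => ?_⟩
    · obtain ⟨a, b, c, d⟩ := h₁ i
      refine ⟨hut i, hvt i, fun s hs hs' => c _ ?_ ?_, ?_⟩
      · rw [← hu']; exact hl hs
      · rw [← hv']; exact hl hs'
      · simpa only [Function.comp_apply, hu', hv'] using d
    · obtain ⟨w, hw, hw'⟩ := h₂ i k hik hj
      rcases hw with ⟨h, h'⟩ | ⟨h, h'⟩
      · have : l (v' i) < l (u' k) := by rw [hv', hu']; exact h.trans h'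
        obtain ⟨s, -, -, rfl⟩ := surj (hl.reflect_lt this).le (hv' i ▸ h.le) (hu' k ▸ h'.le)
        exact ⟨s, Or.inl ⟨hl.reflect_lt (by rwa [hv']), hl.reflect_lt (by rwa [hu'])⟩, hw'⟩
      · have : l (v' k) < l (u' i) := by rw [hv', hu']; exact h.trans h'
        obtain ⟨s, -, -, rfl⟩ := surj (hl.reflect_lt this).le (hv' k ▸ h.le) (hu' i ▸ h'.le)
        exact ⟨s, Or.inr ⟨hl.reflect_lt (by rwa [hv']), hl.reflect_lt (by rwa [hu'])⟩, hw'⟩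

/-- A further section in `[a, b]`, in a strip which does not contain `f a`, can be added to the
sections in `[0, a]`. -/
lemma HasSections.insert {a b : I} {n : ℕ} {r : ℝ} {f : I → ℝ} (h : HasSections a n r f) {j₀ : ℤ}
    {u₀ v₀ : I} (ha : f a ∉ Icc (j₀ : ℝ) (j₀ + 1)) (hau : a ≤ u₀) (huv : u₀ ≤ v₀) (hvb : v₀ ≤ b)
    (hf : ∀ s, u₀ ≤ s → s ≤ v₀ → f s ∈ Icc (j₀ : ℝ) (j₀ + 1)) (hr : r ≤ |f u₀ - f v₀|) :
    HasSections b (n + 1) r f := by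
  obtain ⟨j, u, v, h₁, h₂⟩ := h
  -- The point `a` itself is the separator: its value is outside the new strip, so old sections of
  -- that strip end strictly before `a` and the new one starts strictly after.
  have hau' : a < u₀ := hau.lt_of_ne (by rintro rfl; exact ha (hf _ le_rfl huv))
  have hlt : ∀ i, j i = j₀ → v i < a := fun i hi =>
    (h₁ i).2.1.lt_of_ne (by
      intro h; apply ha; rw [← h, ← hi]; exact (h₁ i).2.2.1 _ (h₁ i).1 le_rfl)
  refine ⟨Fin.cons j₀ j, Fin.cons u₀ u, Fin.cons v₀ v, fun i => ?_, fun i k => ?_⟩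
  · refine Fin.cases ?_ (fun i => ?_) i
    · exact ⟨huv, hvb, hf, hr⟩
    · obtain ⟨c, d, e, g⟩ := h₁ i
      exact ⟨c, d.trans (hau.trans (huv.trans hvb)), e, g⟩
  · refine Fin.cases ?_ (fun i => ?_) i <;> refine Fin.cases ?_ (fun k => ?_) k
    · simp
    · intro _ hj
      simp only [Fin.cons_zero, Fin.cons_succ] at hj ⊢
      exact ⟨a, Or.inr ⟨hlt k hj.symm, hau'⟩, ha⟩
    · intro _ hj
      simp only [Fin.cons_zero, Fin.cons_succ] at hj ⊢
      exact ⟨a, Or.inl ⟨hlt i hj, hau'⟩, hj ▸ ha⟩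
    · intro hik hj
      simp only [Fin.cons_succ] at hj ⊢
      exact h₂ i k (fun h => hik (by rw [h])) hj

lemma hasSections_zero_of_section {b : I} {r : ℝ} {f : I → ℝ} {j₀ : ℤ} {u₀ v₀ : I} (huv : u₀ ≤ v₀)
    (hvb : v₀ ≤ b) (hf : ∀ s, u₀ ≤ s → s ≤ v₀ → f s ∈ Icc (j₀ : ℝ) (j₀ + 1))
    (hr : r ≤ |f u₀ - f v₀|) : HasSections b 0 r f :=
  ⟨fun _ => j₀, fun _ => u₀, fun _ => v₀, fun _ => ⟨huv, hvb, hf, hr⟩,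
    fun i k hik => (hik (by omega)).elim⟩

/-- Take for `v` the first point with value at least `d`, and for `u` the last point before `v` with
value at most `c`. -/
lemma exists_crossing {f : I → ℝ} (hf : Continuous f) {a b : I} (hab : a ≤ b) {c d : ℝ}
    (hcd : c ≤ d) (ha : f a ≤ c) (hb : d ≤ f b) :
    ∃ u v, a ≤ u ∧ u ≤ v ∧ v ≤ b ∧ f u = c ∧ f v = d ∧
      ∀ s, u ≤ s → s ≤ v → f s ∈ Icc c d := by
  obtain ⟨v, ⟨⟨hav, hvb⟩, hv⟩, hvmin⟩ :=
    ((isCompact_Icc (a := a) (b := b)).inter_right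
      (isClosed_le continuous_const hf : IsClosed {s | d ≤ f s})).exists_isLeast
      ⟨b, ⟨hab, le_rfl⟩, hb⟩
  have hvd : f v = d := by
    obtain ⟨s, hs, h⟩ := intermediate_value_Icc hav hf.continuousOn ⟨ha.trans hcd, hv⟩
    have : v ≤ s := hvmin ⟨⟨hs.1, hs.2.trans hvb⟩, h.ge⟩
    rw [le_antisymm this hs.2, h]
  obtain ⟨u, ⟨⟨hau, huv⟩, hu⟩, humax⟩ :=
    ((isCompact_Icc (a := a) (b := v)).inter_right
      (isClosed_le hf continuous_const : IsClosed {s | f s ≤ c})).exists_isGreatest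
      ⟨a, ⟨le_rfl, hav⟩, ha⟩
  have huc : f u = c := by
    obtain ⟨s, hs, h⟩ := intermediate_value_Icc huv hf.continuousOn ⟨hu, hvd ▸ hcd⟩
    have : s ≤ u := humax ⟨⟨hau.trans hs.1, hs.2⟩, h.le⟩
    rw [le_antisymm hs.1 this, h]
  refine ⟨u, v, hau, huv, hvb, huc, hvd, fun s hs hs' => ⟨?_, ?_⟩⟩
  · by_contra! h
    have := le_antisymm hs (humax ⟨⟨hau.trans hs, hs'⟩, h.le⟩)
    exact h.ne (this ▸ huc)
  · by_contra! h
    have := le_antisymm hs' (hvmin ⟨⟨hau.trans (hs), hs'.trans hvb⟩, h.le⟩)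
    exact h.ne' (this ▸ hvd)

/-- If `f` varies by at least `3` between `a` and `b`, then it traverses between `a` and `b` a strip
which does not contain `f a`. -/
lemma exists_section_of_three_le {f : I → ℝ} (hf : Continuous f) {a b : I} (hab : a ≤ b)
    (h : 3 ≤ |f b - f a|) :
    ∃ (j : ℤ) (u v : I), f a ∉ Icc (j : ℝ) (j + 1) ∧ a ≤ u ∧ u ≤ v ∧ v ≤ b ∧
      (∀ s, u ≤ s → s ≤ v → f s ∈ Icc (j : ℝ) (j + 1)) ∧ |f u - f v| = 1 := by
  rcases le_abs.1 h with h | h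
  -- The strip just above the one containing `f a` starts at `⌊f a⌋ + 1 > f a`. The downward case is
  -- its mirror image, with top edge `⌈f a⌉ - 1 < f a`.
  · have h₁ := Int.lt_floor_add_one (f a)
    have h₂ := Int.floor_le (f a)
    obtain ⟨u, v, hau, huv, hvb, hu, hv, H⟩ := exists_crossing hf hab
      (c := (⌊f a⌋ + 1 : ℤ)) (d := (⌊f a⌋ + 1 : ℤ) + 1) (by linarith) (by push_cast; linarith)
      (by push_cast; linarith)
    exact ⟨⌊f a⌋ + 1, u, v, fun h => by have := h.1; push_cast at this; linarith,
      hau, huv, hvb, H, by rw [hu, hv]; norm_num⟩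
  · have h₁ := Int.ceil_lt_add_one (f a)
    have h₂ := Int.le_ceil (f a)
    obtain ⟨u, v, hau, huv, hvb, hu, hv, H⟩ := exists_crossing (f := fun s => -f s) hf.neg hab
      (c := -((⌈f a⌉ - 2 : ℤ) + 1)) (d := -(⌈f a⌉ - 2 : ℤ)) (by linarith)
      (by push_cast; linarith) (by push_cast; linarith)
    refine ⟨⌈f a⌉ - 2, u, v, fun h => by have := h.2; push_cast at this; linarith,
      hau, huv, hvb, fun s hs hs' => ?_, ?_⟩
    · have := H s hs hs'
      exact ⟨by linarith [this.2], by linarith [this.1]⟩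
    · have e : f u - f v = 1 := by linarith
      rw [e]; norm_num

/-! ### Generic functions and stability of sections -/

/-- No integer is a local extremum value of `f`. -/
def Generic (f : I → ℝ) : Prop := ∀ p, IsLocalExtr f p → ∀ j : ℤ, f p ≠ j

/-- Touching the boundary of a strip without leaving it would be a local extremum at an integer
value. -/
lemma Generic.mem_Ioo {f : I → ℝ} (hf : Generic f) {j : ℤ} {u v p : I}
    (h : ∀ s, u < s → s < v → f s ∈ Icc (j : ℝ) (j + 1)) (hu : u < p) (hv : p < v) :
    f p ∈ Ioo (j : ℝ) (j + 1) := by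
  have hp := h p hu hv
  have hn : ∀ᶠ s in 𝓝 p, f s ∈ Icc (j : ℝ) (j + 1) := by
    filter_upwards [Ioo_mem_nhds hu hv] with s hs using h s hs.1 hs.2
  refine ⟨hp.1.lt_of_ne fun e => ?_, hp.2.lt_of_ne fun e => ?_⟩
  · exact hf p (Or.inl (by filter_upwards [hn] with s hs; rw [← e]; exact hs.1)) j e.symm
  · exact hf p (Or.inr (by filter_upwards [hn] with s hs; rw [e]; exact hs.2)) (j + 1)
      (by push_cast; exact e)

/-- A local extremum value is the supremum or infimum of `f` over some member of a countable basis.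
-/
lemma countable_localExtr_values {X : Type*} [TopologicalSpace X] [SecondCountableTopology X]
    (f : X → ℝ) : {y | ∃ p, IsLocalExtr f p ∧ f p = y}.Countable := by
  have hB := TopologicalSpace.isBasis_countableBasis X
  have hc := TopologicalSpace.countable_countableBasis X
  refine ((hc.image fun B => sSup (f '' B)).union (hc.image fun B => sInf (f '' B))).mono ?_
  rintro y ⟨p, hp | hp, rfl⟩
  · obtain ⟨B, hB', hpB, hs⟩ := hB.mem_nhds_iff.1 hp
    refine Or.inr ⟨B, hB', ?_⟩
    refine IsLeast.csInf_eq ⟨mem_image_of_mem _ hpB, ?_⟩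
    rintro _ ⟨q, hq, rfl⟩
    exact hs hq
  · obtain ⟨B, hB', hpB, hs⟩ := hB.mem_nhds_iff.1 hp
    refine Or.inl ⟨B, hB', ?_⟩
    refine IsGreatest.csSup_eq ⟨mem_image_of_mem _ hpB, ?_⟩
    rintro _ ⟨q, hq, rfl⟩
    exact hs hq

lemma countable_not_generic_sub (f : I → ℝ) : {x : ℝ | ¬ Generic fun s => f s - x}.Countable := by
  have := (countable_localExtr_values f)
  refine (countable_iUnion fun j : ℤ => this.image fun y => y - j).mono ?_
  intro x hx
  simp only [Generic, mem_ofPred_eq, not_forall, not_not] at hx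
  obtain ⟨p, hp, j, hj⟩ := hx
  refine mem_iUnion.2 ⟨j, f p, ⟨p, ?_, rfl⟩, by simp only at *; linarith⟩
  refine hp.imp (fun h => ?_) (fun h => ?_)
  · filter_upwards [h] with s hs
    simpa using hs
  · filter_upwards [h] with s hs
    simpa using hs

/-- Lower semicontinuity. Staying in a closed strip is not an open condition, but on slightly
shorter intervals a generic `f` lies in the open strip; the slack `r' < r` pays for the shortening.
-/
lemma HasSections.eventually {f : C(I, ℝ)} (hf : Generic f) {t : I} {n : ℕ} {r r' : ℝ}
    (h : HasSections t n r f) (hr' : 0 < r') (hr : r' < r) :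
    ∀ᶠ g : C(I, ℝ) in 𝓝 f, HasSections t n r' g := by
  obtain ⟨j, u, v, h₁, h₂⟩ := h
  have shrink : ∀ i, ∃ u' v', u i < u' ∧ u' ≤ v' ∧ v' < v i ∧ r' < |f u' - f v'| := fun i => by
    obtain ⟨a, b, c, d⟩ := h₁ i
    have huv : u i < v i := a.lt_of_ne fun e => by
      rw [e, sub_self, abs_zero] at d; linarith
    have hc : Tendsto (fun p : I × I => |f p.1 - f p.2|) (𝓝[>] (u i) ×ˢ 𝓝[<] (v i))
        (𝓝 |f (u i) - f (v i)|) := by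
      have : Continuous fun p : I × I => |f p.1 - f p.2| := by fun_prop
      refine (this.tendsto (u i, v i)).mono_left ?_
      rw [nhds_prod_eq]
      exact prod_mono nhdsWithin_le_nhds nhdsWithin_le_nhds
    obtain ⟨m, hm, hm'⟩ := exists_between huv
    have e₁ : ∀ᶠ p : I × I in 𝓝[>] (u i) ×ˢ 𝓝[<] (v i),
        (u i < p.1 ∧ p.1 < m) ∧ (m < p.2 ∧ p.2 < v i) :=
      prod_mem_prod (Ioo_mem_nhdsGT hm) (Ioo_mem_nhdsLT hm')
    have : (𝓝[>] (u i)).NeBot := nhdsGT_neBot_of_exists_gt ⟨_, huv⟩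
    have : (𝓝[<] (v i)).NeBot := nhdsLT_neBot_of_exists_lt ⟨_, huv⟩
    obtain ⟨p, hp, hp'⟩ := (e₁.and (hc.eventually (lt_mem_nhds (hr.trans_le d)))).exists
    exact ⟨p.1, p.2, hp.1.1, (hp.1.2.trans hp.2.1).le, hp.2.2, hp'⟩
  choose u' v' hu huv hv hd using shrink
  have e₁ : ∀ i, ∀ᶠ g : C(I, ℝ) in 𝓝 f, MapsTo g (Icc (u' i) (v' i)) (Ioo (j i : ℝ) (j i + 1)) :=
    fun i => ContinuousMap.eventually_mapsTo isCompact_Icc isOpen_Ioo fun s hs =>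
      hf.mem_Ioo (fun s hs hs' => (h₁ i).2.2.1 s hs.le hs'.le) ((hu i).trans_le hs.1)
        (hs.2.trans_lt (hv i))
  have e₂ : ∀ i, ∀ᶠ g : C(I, ℝ) in 𝓝 f, r' < |g (u' i) - g (v' i)| := fun i => by
    have : Continuous fun g : C(I, ℝ) => |g (u' i) - g (v' i)| := by fun_prop
    exact this.continuousAt.eventually (lt_mem_nhds (hd i))
  have e₃ : ∀ i k, ∀ᶠ g : C(I, ℝ) in 𝓝 f, i ≠ k → j i = j k →
      ∃ w, (v i < w ∧ w < u k ∨ v k < w ∧ w < u i) ∧ g w ∉ Icc (j i : ℝ) (j i + 1) := fun i k => by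
    by_cases hik : i ≠ k ∧ j i = j k
    · obtain ⟨w, hw, hw'⟩ := h₂ i k hik.1 hik.2
      have : Continuous fun g : C(I, ℝ) => g w := by fun_prop
      filter_upwards [this.continuousAt.eventually (isClosed_Icc.isOpen_compl.mem_nhds hw')]
        with g hg _ _
      exact ⟨w, hw, hg⟩
    · exact Eventually.of_forall fun g h h' => (hik ⟨h, h'⟩).elim
  filter_upwards [eventually_all.2 e₁, eventually_all.2 e₂,
    eventually_all.2 fun i => eventually_all.2 (e₃ i)] with g g₁ g₂ g₃
  refine ⟨j, u', v', fun i => ⟨huv i, (hv i).le.trans (h₁ i).2.1, fun s hs hs' =>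
    Ioo_subset_Icc_self (g₁ i ⟨hs, hs'⟩), (g₂ i).le⟩, fun i k hik hj => ?_⟩
  obtain ⟨w, hw, hw'⟩ := g₃ i k hik hj
  exact ⟨w, hw.imp (fun h => ⟨(hv i).trans h.1, h.2.trans (hu k)⟩)
    (fun h => ⟨(hv k).trans h.1, h.2.trans (hu i)⟩), hw'⟩

/-- Upper semicontinuity, by compactness: the witnesses of nearby functions converge along an
ultrafilter. Only the separators need genericity, since their limits are merely outside the open
strip. -/
lemma HasSections.of_frequently {f : C(I, ℝ)} (hf : Generic f) {t : I} {n : ℕ} {r : ℝ}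
    (hr : 0 < r) (h : ∃ᶠ g : C(I, ℝ) in 𝓝 f, HasSections t n r g) : HasSections t n r f := by
  have hne : (𝓝 f ⊓ 𝓟 {g : C(I, ℝ) | HasSections t n r g}).NeBot := frequently_mem_iff_neBot.1 h
  obtain ⟨U, hU⟩ := Ultrafilter.exists_le (𝓝 f ⊓ 𝓟 {g : C(I, ℝ) | HasSections t n r g})
  have hUW : ∀ᶠ g : C(I, ℝ) in U, HasSections t n r g := le_principal_iff.1 (hU.trans inf_le_right)
  replace hU : ↑U ≤ 𝓝 f := hU.trans inf_le_left
  choose! j u v h₁ h₂ using fun (g : C(I, ℝ)) (hg : HasSections t n r g) => hg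
  choose! w hw hw' using h₂
  have lim : ∀ a : C(I, ℝ) → I, ∃ b, Tendsto a U (𝓝 b) := fun a => by
    obtain ⟨b, -, hb⟩ := isCompact_univ.ultrafilter_le_nhds (U.map a) (by simp)
    exact ⟨b, hb⟩
  have ev : ∀ {a : C(I, ℝ) → I} {b : I}, Tendsto a U (𝓝 b) →
      Tendsto (fun g : C(I, ℝ) => g (a g)) U (𝓝 (f b)) := fun {a b} hb => by
    have hc : Continuous fun p : C(I, ℝ) × I => p.1 p.2 := by fun_prop
    exact (hc.tendsto (f, b)).comp ((tendsto_id.mono_left hU).prodMk_nhds hb)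
  have le : ∀ {a a' : C(I, ℝ) → I} {b b' : I}, Tendsto a U (𝓝 b) → Tendsto a' U (𝓝 b') →
      (∀ᶠ g in U, a g ≤ a' g) → b ≤ b' := fun h h' H => le_of_tendsto_of_tendsto h h' H
  choose u' hu' using fun i => lim fun g => u g i
  choose v' hv' using fun i => lim fun g => v g i
  choose w' hlw using fun i k => lim fun g => w g i k
  -- The values at the left endpoints converge, so the strip indices lie in a finite set and are
  -- constant along the ultrafilter.
  have hj : ∀ i, ∃ j' : ℤ, ∀ᶠ g in U, j g i = j' := fun i => by
    have hb : ∀ᶠ g : C(I, ℝ) in U, g (u g i) ∈ Ioo (f (u' i) - 1) (f (u' i) + 1) :=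
      (ev (hu' i)).eventually (Ioo_mem_nhds (by linarith) (by linarith))
    have hm : Icc (⌊f (u' i)⌋ - 3) (⌊f (u' i)⌋ + 3) ∈ U.map fun g => j g i := by
      rw [Ultrafilter.mem_map]
      filter_upwards [hb, hUW] with g hg hW
      obtain ⟨a, -, c, -⟩ := h₁ g hW i
      have hc := c _ le_rfl a
      have f₁ := Int.floor_le (f (u' i))
      have f₂ := Int.lt_floor_add_one (f (u' i))
      constructor
      · have : ((⌊f (u' i)⌋ - 3 : ℤ) : ℝ) < j g i := by push_cast; linarith [hc.2, hg.1]
        exact (Int.cast_lt.1 this).le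
      · have : (j g i : ℝ) < ((⌊f (u' i)⌋ + 3 : ℤ) : ℝ) := by push_cast; linarith [hc.1, hg.2]
        exact (Int.cast_lt.1 this).le
    obtain ⟨j', -, hj'⟩ := Ultrafilter.eq_pure_of_finite_mem (finite_Icc _ _) hm
    have : ({j'} : Set ℤ) ∈ U.map fun g => j g i := by rw [hj']; exact mem_pure.2 rfl
    exact ⟨j', this⟩
  choose j' hj' using hj
  have hle : ∀ i, u' i ≤ v' i := fun i => le (hu' i) (hv' i) (by
    filter_upwards [hUW] with g hW using (h₁ g hW i).1)
  have hmem : ∀ i s, u' i ≤ s → s ≤ v' i → f s ∈ Icc (j' i : ℝ) (j' i + 1) := fun i s hs hs' => by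
    -- Clamping `s` to the intervals of `g` gives points that tend to `s` and at which `g` is in the
    -- strip.
    have ht : Tendsto (fun g => max (u g i) (min s (v g i))) U (𝓝 s) := by
      have := (hu' i).max ((tendsto_const_nhds (x := s)).min (hv' i))
      rwa [min_eq_left hs', max_eq_right hs] at this
    refine isClosed_Icc.mem_of_tendsto (ev ht) ?_
    filter_upwards [hUW, hj' i] with g hW hg
    obtain ⟨a, -, c, -⟩ := h₁ g hW i
    rw [← hg]
    exact c _ (le_max_left _ _) (max_le a (min_le_right _ _))
  have hdist : ∀ i, r ≤ |f (u' i) - f (v' i)| := fun i => by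
    refine ge_of_tendsto ((ev (hu' i)).sub (ev (hv' i))).abs ?_
    filter_upwards [hUW] with g hW using (h₁ g hW i).2.2.2
  have hlt : ∀ i, u' i < v' i := fun i => (hle i).lt_of_ne fun e => by
    have := hdist i
    rw [e, sub_self, abs_zero] at this
    exact hr.not_ge this
  -- If no point between the two limit intervals left the closed strip, `f` would stay in it on
  -- their whole hull, hence in the open strip at the limit separator, a contradiction.
  have sep : ∀ i k, j' i = j' k → v' i ≤ w' i k → w' i k ≤ u' k →
      f (w' i k) ∉ Ioo (j' i : ℝ) (j' i + 1) →
      ∃ p, v' i < p ∧ p < u' k ∧ f p ∉ Icc (j' i : ℝ) (j' i + 1) := fun i k hj hi hk hf' => by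
    by_contra! H
    refine hf' (hf.mem_Ioo (u := u' i) (v := v' k) (fun s hs hs' => ?_)
      ((hlt i).trans_le hi) (hk.trans_lt (hlt k)))
    rcases le_or_gt s (v' i) with h | h
    · exact hmem i s hs.le h
    · rcases lt_or_ge s (u' k) with h' | h'
      · exact H s h h'
      · rw [hj]; exact hmem k s h' hs'.le
  refine ⟨j', u', v', fun i => ⟨hle i, ?_, hmem i, hdist i⟩, fun i k hik hjk => ?_⟩
  · refine le (hv' i) tendsto_const_nhds ?_
    filter_upwards [hUW] with g hW using (h₁ g hW i).2.1
  · have hout : ∀ᶠ g in U, (v g i < w g i k ∧ w g i k < u g k ∨ v g k < w g i k ∧ w g i k < u g i) ∧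
        g (w g i k) ∈ (Ioo (j' i : ℝ) (j' i + 1))ᶜ := by
      filter_upwards [hUW, hj' i, hj' k] with g hW hi hk
      have e : j g i = j g k := by rw [hi, hk, hjk]
      refine ⟨hw g hW i k hik e, fun h => hw' g hW i k hik e ?_⟩
      rw [hi]
      exact Ioo_subset_Icc_self h
    have hf' : f (w' i k) ∉ Ioo (j' i : ℝ) (j' i + 1) :=
      isOpen_Ioo.isClosed_compl.mem_of_tendsto (ev (hlw i k)) (hout.mono fun g hg => hg.2)
    rcases Ultrafilter.eventually_or.1 (hout.mono fun g hg => hg.1) with H | H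
    · obtain ⟨p, h, h', hp⟩ := sep i k hjk (le (hv' i) (hlw i k) (H.mono fun g hg => hg.1.le))
        (le (hlw i k) (hu' k) (H.mono fun g hg => hg.2.le)) hf'
      exact ⟨p, Or.inl ⟨h, h'⟩, hp⟩
    · by_contra! Hn
      refine hf' (hf.mem_Ioo (u := u' k) (v := v' i) (fun s hs hs' => ?_)
        ((hlt k).trans_le (le (hv' k) (hlw i k) (H.mono fun g hg => hg.1.le)))
        ((le (hlw i k) (hu' i) (H.mono fun g hg => hg.2.le)).trans_lt (hlt i)))
      rcases le_or_gt s (v' k) with h | h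
      · rw [hjk]; exact hmem k s hs.le h
      · rcases lt_or_ge s (u' i) with h' | h'
        · exact Hn s (Or.inr ⟨h, h'⟩)
        · exact hmem i s h' hs'.le

/-! ### Ordered widths and their weighted sum -/

/-- The largest `r` for which `f` has more than `n` sections of width at least `r`. -/
noncomputable def sectionWidth (t : I) (n : ℕ) (f : I → ℝ) : ℝ≥0∞ :=
  ⨆ (r : ℝ≥0) (_ : HasSections t n r f), (r : ℝ≥0∞)

noncomputable def sectionSum (t : I) (f : I → ℝ) : ℝ≥0∞ :=
  ∑' n : ℕ, sectionWidth t n f / 2 ^ n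

lemma HasSections.le_sectionWidth {t : I} {n : ℕ} {r : ℝ≥0} {f : I → ℝ}
    (h : HasSections t n r f) : (r : ℝ≥0∞) ≤ sectionWidth t n f :=
  le_iSup₂ (f := fun (r : ℝ≥0) (_ : HasSections t n r f) => (r : ℝ≥0∞)) r h

lemma sectionWidth_le_one (t : I) (n : ℕ) (f : I → ℝ) : sectionWidth t n f ≤ 1 :=
  iSup₂_le fun r h => by exact_mod_cast h.le_one

lemma tsum_one_div_two_pow : ∑' n : ℕ, (1 : ℝ≥0∞) / 2 ^ n = 2 := by
  simp_rw [one_div, ENNReal.inv_pow]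
  rw [ENNReal.tsum_geometric, ENNReal.one_sub_inv_two, inv_inv]

lemma sectionSum_le_two (t : I) (f : I → ℝ) : sectionSum t f ≤ 2 :=
  (ENNReal.tsum_le_tsum fun n => ENNReal.div_le_div_right (sectionWidth_le_one t n f) _).trans
    tsum_one_div_two_pow.le

lemma sectionWidth_comp {l : I → I} (hl : Monotone l) (hc : Continuous l) (h0 : l 0 = 0) (t : I)
    (n : ℕ) (f : I → ℝ) : sectionWidth t n (f ∘ l) = sectionWidth (l t) n f := by
  simp only [sectionWidth, hasSections_comp hl hc h0]

lemma sectionSum_comp {l : I → I} (hl : Monotone l) (hc : Continuous l) (h0 : l 0 = 0) (t : I)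
    (f : I → ℝ) : sectionSum t (f ∘ l) = sectionSum (l t) f := by
  simp only [sectionSum, sectionWidth_comp hl hc h0]

lemma sectionSum_zero (f : I → ℝ) : sectionSum 0 f = 0 := by
  have : ∀ m, sectionWidth 0 m f = 0 := fun _ => by
    refine le_antisymm (iSup₂_le fun r h => ?_) bot_le
    by_contra hr
    exact not_hasSections_zero (by simpa [pos_iff_ne_zero] using hr) h
  simp [sectionSum, this]

lemma sectionSum_mono {t t' : I} (h : t ≤ t') (f : I → ℝ) : sectionSum t f ≤ sectionSum t' f :=
  ENNReal.tsum_le_tsum fun _ => ENNReal.div_le_div_right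
    (iSup₂_le fun _ hr => (hr.mono h le_rfl le_rfl).le_sectionWidth) _

lemma tendsto_sectionWidth {f : C(I, ℝ)} (hf : Generic f) (t : I) (n : ℕ) :
    Tendsto (fun g : C(I, ℝ) => sectionWidth t n g) (𝓝 f) (𝓝 (sectionWidth t n f)) := by
  refine tendsto_order.2 ⟨fun a ha => ?_, fun a ha => ?_⟩
  · obtain ⟨r, hr⟩ := lt_iSup_iff.1 ha
    obtain ⟨h, har⟩ := lt_iSup_iff.1 hr
    obtain ⟨r', har', hr'⟩ := ENNReal.lt_iff_exists_nnreal_btwn.1 har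
    have hr₀ : 0 < r' := by exact_mod_cast (zero_le : (0 : ℝ≥0∞) ≤ _).trans_lt har'
    filter_upwards [h.eventually hf (r' := r') (by exact_mod_cast hr₀) (by exact_mod_cast hr')]
      with g hg
    exact har'.trans_le hg.le_sectionWidth
  · obtain ⟨r, hr, hra⟩ := ENNReal.lt_iff_exists_nnreal_btwn.1 ha
    have hr₀ : 0 < r := by exact_mod_cast (zero_le : (0 : ℝ≥0∞) ≤ _).trans_lt hr
    have : ∀ᶠ g : C(I, ℝ) in 𝓝 f, ¬ HasSections t n r g := by
      by_contra hn
      rw [← Filter.Frequently] at hn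
      exact hr.not_ge (HasSections.of_frequently hf (by exact_mod_cast hr₀) hn).le_sectionWidth
    filter_upwards [this] with g hg
    refine (iSup₂_le fun r' hr' => ?_ : sectionWidth t n g ≤ r).trans_lt hra
    by_contra! h
    exact hg (hr'.mono le_rfl le_rfl (by exact_mod_cast h.le))

lemma tendsto_sectionSum {f : C(I, ℝ)} (hf : Generic f) (t : I) :
    Tendsto (fun g : C(I, ℝ) => sectionSum t g) (𝓝 f) (𝓝 (sectionSum t f)) := by
  simp only [sectionSum, ← lintegral_count]
  refine tendsto_lintegral_filter_of_dominated_convergence (fun n : ℕ => 1 / 2 ^ n)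
    (Eventually.of_forall fun g => measurable_from_nat)
    (Eventually.of_forall fun g => ae_of_all _ fun n =>
      ENNReal.div_le_div_right (sectionWidth_le_one t n g) _) ?_ (ae_of_all _ fun n => ?_)
  · rw [lintegral_count, tsum_one_div_two_pow]; exact ENNReal.ofNat_ne_top
  · exact ENNReal.Tendsto.div_const (tendsto_sectionWidth hf t n) (Or.inr (by simp))

/-! ### The transverse coordinate and the strips -/

/-- The coordinate of `z` transverse to the direction `e^{tπi}`. -/
noncomputable def transverse (t : ℝ) (z : ℂ) : ℝ :=
  (Complex.exp (-(t * Real.pi * Complex.I)) * z).im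

lemma mem_strip {x t μ : ℝ} (hμ : 0 < μ) {j : ℤ} {z : ℂ} :
    z ∈ strip x t μ j ↔ transverse t z / μ - x ∈ Icc (j : ℝ) (j + 1) := by
  have hμ' : (μ : ℂ) ≠ 0 := by exact_mod_cast hμ.ne'
  constructor
  · rintro ⟨w, ⟨h₁, h₂⟩, rfl⟩
    have : transverse t (μ * Complex.exp (t * Real.pi * Complex.I) * (w + Complex.I * x)) / μ - x
        = w.im := by
      have e : Complex.exp (-(t * Real.pi * Complex.I)) *
          (μ * Complex.exp (t * Real.pi * Complex.I) * (w + Complex.I * x)) =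
          μ * (w + Complex.I * x) := by
        rw [Complex.exp_neg]; field_simp
      rw [transverse, e, Complex.im_ofReal_mul]
      simp
      field_simp
      ring
    simp only [this]
    exact ⟨h₁, h₂⟩
  · intro h
    refine ⟨Complex.exp (-(t * Real.pi * Complex.I)) * z / μ - Complex.I * x, ?_, ?_⟩
    · have : (Complex.exp (-(t * Real.pi * Complex.I)) * z / μ - Complex.I * x).im =
          transverse t z / μ - x := by
        rw [Complex.sub_im, Complex.div_ofReal_im, transverse]; simp
      exact ⟨by rw [this]; exact h.1, by rw [this]; exact h.2⟩
    · simp only [sub_add_cancel, Complex.exp_neg]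
      field_simp

lemma perpProj_eq (t : ℝ) (z : ℂ) :
    perpProj t z = transverse t z • Complex.exp ((t + 1 / 2) * Real.pi * Complex.I) := by
  have hn : ‖Complex.exp ((t + 1 / 2) * Real.pi * Complex.I)‖ = 1 := by
    have := Complex.norm_exp_ofReal_mul_I ((t + 1 / 2) * Real.pi)
    push_cast at this
    exact this
  rw [perpProj, Submodule.starProjection_unit_singleton ℝ hn]
  congr 1
  have hc : (starRingEnd ℂ) (Complex.exp ((t + 1 / 2) * Real.pi * Complex.I)) =
      -Complex.I * Complex.exp (-(t * Real.pi * Complex.I)) := by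
    rw [← Complex.exp_conj]
    have : (starRingEnd ℂ) ((t + 1 / 2) * Real.pi * Complex.I) =
        -(t * Real.pi * Complex.I) + -(Real.pi / 2 * Complex.I) := by
      simp [Complex.conj_ofNat]
      ring
    rw [this, Complex.exp_add, Complex.exp_neg (Real.pi / 2 * Complex.I),
      Complex.exp_pi_div_two_mul_I, Complex.inv_I]
    ring
  rw [Complex.inner, hc, transverse, mul_assoc]
  simp
  ring

lemma edist_perpProj (t : ℝ) (z w : ℂ) :
    edist (perpProj t z) (perpProj t w) = ENNReal.ofReal |transverse t z - transverse t w| := by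
  have hn : ‖Complex.exp ((t + 1 / 2) * Real.pi * Complex.I)‖ = 1 := by
    have := Complex.norm_exp_ofReal_mul_I ((t + 1 / 2) * Real.pi)
    push_cast at this
    exact this
  rw [perpProj_eq, perpProj_eq, edist_dist, dist_eq_norm, ← sub_smul, norm_smul, hn, mul_one,
    Real.norm_eq_abs]

lemma continuous_transverse : Continuous fun p : ℝ × ℂ => transverse p.1 p.2 := by
  unfold transverse; fun_prop

lemma abs_transverse_sub_le (t : ℝ) (z w : ℂ) : |transverse t z - transverse t w| ≤ dist z w := by
  have : transverse t z - transverse t w =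
      (Complex.exp (-(t * Real.pi * Complex.I)) * (z - w)).im := by
    rw [transverse, transverse, mul_sub, Complex.sub_im]
  rw [this]
  refine (Complex.abs_im_le_norm _).trans ?_
  have hn := Complex.norm_exp_ofReal_mul_I (-(t * Real.pi))
  push_cast at hn
  rw [norm_mul, ← neg_mul, hn, one_mul, dist_eq_norm]

/-- The transverse coordinate of `γ`, in units of the strip width `μ`. -/
noncomputable def height (t μ : ℝ) (γ : C(I, ℂ)) : C(I, ℝ) where
  toFun s := transverse t (γ s) / μ
  continuous_toFun := by
    have := continuous_transverse
    exact (this.comp (continuous_const.prodMk γ.continuous)).div_const μ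

lemma height_apply (t μ : ℝ) (γ : C(I, ℂ)) (s : I) : height t μ γ s = transverse t (γ s) / μ := rfl

/-! ### Components correspond to sections -/

section components

variable {γ : C(I, ℂ)} {τ : I} {x t μ : ℝ}

/-- In each of `n + 1` components choose two points nearly realizing its width; the supremum need
not be attained for a general set, hence the loss from `r` to `r'`. Distinct components of one strip
preimage cannot be joined by an interval inside it, which yields the separators. -/
lemma hasSections_of_lt_encard (hμ : 0 < μ) {n : ℕ} {r : ℝ≥0∞}
    (h : (n : ℕ∞) < {C ∈ stripComponents γ (Iic τ) x t μ | r ≤ perpWidth t (γ '' C)}.encard)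
    {r' : ℝ} (hr : ENNReal.ofReal r' < r) :
    HasSections τ n (r' / μ) fun s => height t μ γ s - x := by
  obtain ⟨T, hT, hTc⟩ := exists_subset_encard_eq (Order.add_one_le_of_lt h)
  have hTf : T.Finite := finite_of_encard_eq_coe (k := n + 1) (hTc)
  have hcard : T.ncard = n + 1 := by
    have := hTf.cast_ncard_eq
    rw [hTc] at this
    exact_mod_cast this
  have e : Fin (n + 1) ≃ T := by
    have := hTf.fintype
    exact (Fintype.equivFinOfCardEq (by rw [← Nat.card_eq_fintype_card]; exact hcard)).symm
  set f : I → ℝ := fun s => height t μ γ s - x with hf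
  have H : ∀ i, ∃ (j : ℤ) (u v : I), u ≤ v ∧ u ∈ (e i : Set I) ∧ v ∈ (e i : Set I) ∧
      r' / μ ≤ |f u - f v| ∧
      ∃ p, p ∈ Iic τ ∩ γ ⁻¹' strip x t μ j ∧
        (e i : Set I) = connectedComponentIn (Iic τ ∩ γ ⁻¹' strip x t μ j) p := fun i => by
    obtain ⟨⟨⟨j, p, hp, hC⟩, -⟩, hw⟩ := hT (e i).2
    rw [perpWidth, ← image_comp] at hw
    have hlt := hr.trans_le hw
    obtain ⟨a, ha, b, hb, hab⟩ : ∃ a ∈ (e i : Set I), ∃ b ∈ (e i : Set I),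
        r' < |transverse t (γ a) - transverse t (γ b)| := by
      by_contra! hn
      refine hlt.not_ge (Metric.ediam_le ?_)
      rintro _ ⟨a, ha, rfl⟩ _ ⟨b, hb, rfl⟩
      rw [Function.comp_apply, Function.comp_apply, edist_perpProj]
      exact ENNReal.ofReal_le_ofReal (hn a ha b hb)
    have key : r' / μ ≤ |f a - f b| := by
      have : f a - f b = (transverse t (γ a) - transverse t (γ b)) / μ := by
        simp only [hf, height_apply]; ring
      rw [this, abs_div, abs_of_pos hμ]
      gcongr
    rcases le_total a b with hle | hle
    · exact ⟨j, a, b, hle, ha, hb, key, p, hp, hC⟩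
    · exact ⟨j, b, a, hle, hb, ha, by rwa [abs_sub_comm], p, hp, hC⟩
  choose j u v huv hu hv hd p hp hC using H
  have hmemC : ∀ i s, s ∈ Iic τ ∩ γ ⁻¹' strip x t μ (j i) ↔
      s ≤ τ ∧ f s ∈ Icc (j i : ℝ) (j i + 1) := fun i s => by
    rw [mem_inter_iff, mem_preimage, mem_strip hμ]; rfl
  have hconn : ∀ i, (e i : Set I).OrdConnected := fun i => by
    rw [hC i]; exact isPreconnected_connectedComponentIn.ordConnected
  have hsub : ∀ i s, s ∈ (e i : Set I) → s ≤ τ ∧ f s ∈ Icc (j i : ℝ) (j i + 1) := fun i s hs => by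
    rw [← hmemC]
    rw [hC i] at hs
    exact connectedComponentIn_subset _ _ hs
  have hcomp : ∀ i s, s ∈ (e i : Set I) →
      (e i : Set I) = connectedComponentIn (Iic τ ∩ γ ⁻¹' strip x t μ (j i)) s := fun i s hs => by
    rw [hC i] at hs ⊢
    exact connectedComponentIn_eq hs
  have hdisj : ∀ i k, i ≠ k → j i = j k → ∀ s, s ∈ (e i : Set I) → s ∉ (e k : Set I) :=
    fun i k hik hj s hs hs' => by
      refine hik (e.injective (Subtype.ext ?_))
      rw [hcomp i s hs, hcomp k s hs', hj]
  have hsep : ∀ i k, i ≠ k → j i = j k → v i < u k →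
      ∃ w, v i < w ∧ w < u k ∧ f w ∉ Icc (j i : ℝ) (j i + 1) := fun i k hik hj hlt => by
    by_contra! hn
    refine hdisj i k hik hj (u k) ?_ (hu k)
    rw [hcomp i (v i) (hv i)]
    refine isPreconnected_Icc.subset_connectedComponentIn (left_mem_Icc.2 hlt.le) ?_
      (right_mem_Icc.2 hlt.le)
    intro s hs
    rw [hmemC]
    refine ⟨hs.2.trans (hsub k _ (hu k)).1, ?_⟩
    rcases hs.1.eq_or_lt with h | h
    · rw [← h]; exact (hsub i _ (hv i)).2
    · rcases hs.2.eq_or_lt with h' | h'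
      · rw [h', hj]; exact (hsub k _ (hu k)).2
      · exact hn s h h'
  refine ⟨j, u, v, fun i => ⟨huv i, (hsub i _ (hv i)).1, fun s hs hs' =>
    (hsub i s ((hconn i).out (hu i) (hv i) ⟨hs, hs'⟩)).2, hd i⟩, fun i k hik hj => ?_⟩
  rcases lt_or_ge (v i) (u k) with h | h
  · obtain ⟨w, h₁, h₂, h₃⟩ := hsep i k hik hj h
    exact ⟨w, Or.inl ⟨h₁, h₂⟩, h₃⟩
  · rcases lt_or_ge (v k) (u i) with h' | h'
    · obtain ⟨w, h₁, h₂, h₃⟩ := hsep k i hik.symm hj.symm h'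
      exact ⟨w, Or.inr ⟨h₁, h₂⟩, hj ▸ h₃⟩
    · exfalso
      rcases le_total (u i) (u k) with h₁ | h₁
      · exact hdisj i k hik hj (u k) ((hconn i).out (hu i) (hv i) ⟨h₁, h⟩) (hu k)
      · exact hdisj i k hik hj (u i) (hu i) ((hconn k).out (hu k) (hv k) ⟨h₁, h'⟩)

/-- The sections lie in distinct components: for equal strips because of the separators, for
different strips because two strips share at most a boundary line, whose width is zero. -/
lemma lt_encard_of_hasSections (hμ : 0 < μ) {n : ℕ} {r : ℝ} (hr : 0 < r)
    (h : HasSections τ n r fun s => height t μ γ s - x) :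
    (n : ℕ∞) < {C ∈ stripComponents γ (Iic τ) x t μ |
      ENNReal.ofReal (μ * r) ≤ perpWidth t (γ '' C)}.encard := by
  obtain ⟨j, u, v, h₁, h₂⟩ := h
  set f : I → ℝ := fun s => height t μ γ s - x with hf
  set S : ℤ → Set I := fun j => Iic τ ∩ γ ⁻¹' strip x t μ j with hS
  have hmemS : ∀ j s, s ∈ S j ↔ s ≤ τ ∧ f s ∈ Icc (j : ℝ) (j + 1) := fun i s => by
    simp only [hS]; rw [mem_inter_iff, mem_preimage, mem_strip hμ]; rfl
  set C : Fin (n + 1) → Set I := fun i => connectedComponentIn (S (j i)) (u i) with hC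
  have huS : ∀ i, u i ∈ S (j i) := fun i =>
    (hmemS _ _).2 ⟨(h₁ i).1.trans (h₁ i).2.1, (h₁ i).2.2.1 _ le_rfl (h₁ i).1⟩
  have hu : ∀ i, u i ∈ C i := fun i => mem_connectedComponentIn (huS i)
  have hv : ∀ i, v i ∈ C i := fun i => by
    refine isPreconnected_Icc.subset_connectedComponentIn (left_mem_Icc.2 (h₁ i).1) ?_
      (right_mem_Icc.2 (h₁ i).1)
    intro s hs
    exact (hmemS _ _).2 ⟨hs.2.trans (h₁ i).2.1, (h₁ i).2.2.1 s hs.1 hs.2⟩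
  have hsub : ∀ i s, s ∈ C i → f s ∈ Icc (j i : ℝ) (j i + 1) := fun i s hs =>
    ((hmemS _ _).1 (connectedComponentIn_subset _ _ hs)).2
  have hconn : ∀ i, (C i).OrdConnected := fun i =>
    isPreconnected_connectedComponentIn.ordConnected
  have hdiff : ∀ i, |transverse t (γ (u i)) - transverse t (γ (v i))| =
      μ * |f (u i) - f (v i)| := fun i => by
    have : f (u i) - f (v i) = (transverse t (γ (u i)) - transverse t (γ (v i))) / μ := by
      simp only [hf, height_apply]; ring
    rw [this, abs_div, abs_of_pos hμ]
    field_simp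
  have hpos : ∀ i, 0 < |f (u i) - f (v i)| := fun i => hr.trans_le (h₁ i).2.2.2
  have hstrip : ∀ i k, C i = C k → j i ≤ j k := fun i k h => by
    by_contra! hlt
    have hjk : (j k : ℝ) + 1 ≤ j i := by exact_mod_cast hlt
    have hu₁ := hsub i _ (hu i)
    have hu₂ := hsub k _ (h ▸ hu i)
    have hv₁ := hsub i _ (hv i)
    have hv₂ := hsub k _ (h ▸ hv i)
    have : f (u i) - f (v i) = 0 := by linarith [hu₁.1, hu₂.2, hv₁.1, hv₂.2]
    exact (hpos i).ne' (by rw [this, abs_zero])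
  have hinj : Function.Injective C := fun i k h => by
    by_contra hik
    obtain ⟨w, hw, hw'⟩ := h₂ i k hik (le_antisymm (hstrip i k h) (hstrip k i h.symm))
    refine hw' (hsub i w ?_)
    rcases hw with hw | hw
    · exact (hconn i).out (hv i) (h ▸ hu k) ⟨hw.1.le, hw.2.le⟩
    · exact (hconn i).out (h ▸ hv k) (hu i) ⟨hw.1.le, hw.2.le⟩
  have hedist : ∀ i, edist (perpProj t (γ (u i))) (perpProj t (γ (v i))) =
      ENNReal.ofReal (μ * |f (u i) - f (v i)|) := fun i => by rw [edist_perpProj, hdiff]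
  have hmem : ∀ i, perpProj t (γ (u i)) ∈ perpProj t '' (γ '' C i) ∧
      perpProj t (γ (v i)) ∈ perpProj t '' (γ '' C i) := fun i =>
    ⟨mem_image_of_mem _ (mem_image_of_mem _ (hu i)), mem_image_of_mem _ (mem_image_of_mem _ (hv i))⟩
  have hrange : range C ⊆ {C ∈ stripComponents γ (Iic τ) x t μ |
      ENNReal.ofReal (μ * r) ≤ perpWidth t (γ '' C)} := by
    rintro _ ⟨i, rfl⟩
    refine ⟨⟨⟨j i, u i, huS i, rfl⟩, _, (hmem i).1, _, (hmem i).2, fun h => ?_⟩, ?_⟩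
    · have := hedist i
      rw [h, edist_self, eq_comm, ENNReal.ofReal_eq_zero] at this
      exact this.not_gt (mul_pos hμ (hpos i))
    · refine le_trans ?_ (Metric.edist_le_ediam_of_mem (hmem i).1 (hmem i).2)
      rw [hedist]
      exact ENNReal.ofReal_le_ofReal (mul_le_mul_of_nonneg_left (h₁ i).2.2.2 hμ.le)
  refine lt_of_lt_of_le ?_ (encard_le_encard hrange)
  rw [← image_univ, hinj.encard_image, encard_univ]
  simp only [ENat.card_eq_coe_fintype_card, Fintype.card_fin]
  exact_mod_cast Nat.lt_succ_self n

lemma sortedWidth_eq (hμ : 0 < μ) (n : ℕ) :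
    sortedWidth γ (Iic τ) x t μ n =
      ENNReal.ofReal μ * sectionWidth τ n fun s => height t μ γ s - x := by
  apply le_antisymm
  · refine iSup₂_le fun r hr => le_of_forall_lt fun a ha => ?_
    obtain ⟨r', har', hr'⟩ := ENNReal.lt_iff_exists_nnreal_btwn.1 ha
    have h := hasSections_of_lt_encard (r' := r') hμ hr (by simpa using hr')
    have h' : HasSections τ n ((r'.toReal / μ).toNNReal : ℝ≥0) fun s => height t μ γ s - x := by
      rwa [Real.coe_toNNReal _ (by positivity)]
    refine har'.trans_le (le_trans (le_of_eq ?_) (mul_le_mul_right h'.le_sectionWidth _))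
    change _ = _ * ENNReal.ofReal _
    rw [← ENNReal.ofReal_mul hμ.le, mul_div_cancel₀ _ hμ.ne', ENNReal.ofReal_coe_nnreal]
  · simp only [sectionWidth, ENNReal.mul_iSup]
    refine iSup₂_le fun r hr => ?_
    rcases eq_or_ne r 0 with rfl | h0
    · simp
    have h := lt_encard_of_hasSections hμ (by simpa [pos_iff_ne_zero] using h0) hr
    refine le_trans (le_of_eq ?_) (le_iSup₂ (f := fun (r : ℝ≥0∞) _ => r) _ h)
    rw [ENNReal.ofReal_mul hμ.le, ENNReal.ofReal_coe_nnreal]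

lemma stripLength_eq (hμ : 0 < μ) :
    stripLength γ (Iic τ) x t μ =
      ENNReal.ofReal μ * sectionSum τ fun s => height t μ γ s - x := by
  simp only [stripLength, sectionSum, sortedWidth_eq hμ, ← ENNReal.tsum_mul_left, mul_div_assoc]

end components

/-! ### Continuity of the length in the uniform topology -/

/-- The average over all positions of the grid of strips. -/
noncomputable def gridAverage (h : C(I, ℝ)) : ℝ≥0∞ :=
  ∫⁻ x in Icc (0 : ℝ) 1, sectionSum 1 fun s => h s - x

lemma gridAverage_le_two (h : C(I, ℝ)) : gridAverage h ≤ 2 :=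
  (setLIntegral_mono measurable_const fun _ _ => sectionSum_le_two _ _).trans (by simp)

lemma ae_generic_sub (h : C(I, ℝ)) : ∀ᵐ x : ℝ, Generic fun s => h s - x :=
  (countable_not_generic_sub h).ae_notMem volume |>.mono fun x hx => by simpa using hx

lemma continuousAt_sectionSum_sub (h : C(I, ℝ)) {x : ℝ} (hx : Generic fun s => h s - x) :
    ContinuousAt (fun x : ℝ => sectionSum 1 fun s => h s - x) x := by
  have hcont : Continuous fun x : ℝ => h - ContinuousMap.const I x := by fun_prop
  have := (tendsto_sectionSum (f := h - ContinuousMap.const I x) hx 1).comp (hcont.tendsto x)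
  exact this

/-- The integrand is continuous at every generic offset, that is, off a countable set. -/
lemma aemeasurable_sectionSum_sub (h : C(I, ℝ)) :
    AEMeasurable (fun x : ℝ => sectionSum 1 fun s => h s - x) := by
  obtain ⟨B, hB⟩ : ∃ B : Set ℝ, B = {x : ℝ | ¬ Generic fun s => h s - x} := ⟨_, rfl⟩
  have hBc : B.Countable := hB ▸ countable_not_generic_sub h
  have hc : ContinuousOn (fun x : ℝ => sectionSum 1 fun s => h s - x) Bᶜ := fun x hx => by
    refine (continuousAt_sectionSum_sub h ?_).continuousWithinAt
    by_contra hn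
    exact hx (hB ▸ hn)
  have := hc.aemeasurable hBc.measurableSet.compl (μ := volume)
  have hae : ∀ᵐ x : ℝ, x ∈ Bᶜ := hBc.ae_notMem volume
  rwa [Measure.restrict_eq_self_of_ae_mem hae] at this

lemma continuous_gridAverage : Continuous gridAverage := by
  refine continuous_iff_continuousAt.2 fun h => ?_
  unfold ContinuousAt gridAverage
  refine tendsto_lintegral_filter_of_dominated_convergence' (fun _ => 2)
    (Eventually.of_forall fun g => (aemeasurable_sectionSum_sub g).restrict)
    (Eventually.of_forall fun g => ae_of_all _ fun _ => sectionSum_le_two _ _) (by simp)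
    (ae_restrict_of_ae ?_)
  filter_upwards [ae_generic_sub h] with x hx
  have hcont : Continuous fun g : C(I, ℝ) => g - ContinuousMap.const I x := by fun_prop
  have := (tendsto_sectionSum (f := h - ContinuousMap.const I x) hx 1).comp (hcont.tendsto h)
  exact this

lemma height_eq_smul (t μ : ℝ) (γ : C(I, ℂ)) : height t μ γ = μ⁻¹ • height t 1 γ := by
  ext s
  simp [height_apply, div_eq_inv_mul]

lemma continuousAt_height {p : C(I, ℂ) × ℝ × ℝ} (hp : p.2.1 ≠ 0) :
    ContinuousAt (fun p : C(I, ℂ) × ℝ × ℝ => height p.2.2 p.2.1 p.1) p := by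
  have h₁ : Continuous fun p : C(I, ℂ) × ℝ × ℝ => height p.2.2 1 p.1 := by
    refine ContinuousMap.continuous_of_continuous_uncurry _ ?_
    have : Continuous fun q : (C(I, ℂ) × ℝ × ℝ) × I => (q.1.2.2, q.1.1 q.2) := by fun_prop
    exact (continuous_transverse.comp this).div_const 1
  simp only [fun p : C(I, ℂ) × ℝ × ℝ => height_eq_smul p.2.2 p.2.1 p.1]
  exact ((continuous_snd.fst.continuousAt).inv₀ hp).smul h₁.continuousAt

/-- The length of `γ`, as an extended real number. -/
noncomputable def totalLength (γ : C(I, ℂ)) : ℝ≥0∞ :=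
  ∫⁻ μ in Ioc (0 : ℝ) 1, ∫⁻ t in Icc (0 : ℝ) 1, ENNReal.ofReal μ * gridAverage (height t μ γ)

/-- Joint continuity in path and scale serves twice: for measurability in `μ` and for the limit in
`γ`. -/
lemma continuousAt_directionAverage {p : C(I, ℂ) × ℝ} (hp : 0 < p.2) :
    ContinuousAt (fun p : C(I, ℂ) × ℝ => ∫⁻ t in Icc (0 : ℝ) 1,
      ENNReal.ofReal p.2 * gridAverage (height t p.2 p.1)) p := by
  have hpos : ∀ᶠ q : C(I, ℂ) × ℝ in 𝓝 p, 0 < q.2 :=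
    continuous_snd.continuousAt.eventually (lt_mem_nhds hp)
  have hlt : ∀ᶠ q : C(I, ℂ) × ℝ in 𝓝 p, q.2 < p.2 + 1 :=
    continuous_snd.continuousAt.eventually (gt_mem_nhds (by linarith))
  refine tendsto_lintegral_filter_of_dominated_convergence
    (fun _ => ENNReal.ofReal (p.2 + 1) * 2) ?_ ?_ ?_ (ae_of_all _ fun t => ?_)
  · filter_upwards [hpos] with q hq
    refine Continuous.measurable (ENNReal.continuous_const_mul ENNReal.ofReal_ne_top |>.comp
      (continuous_gridAverage.comp (continuous_iff_continuousAt.2 fun t => ?_)))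
    have hc : Continuous fun t : ℝ => (q.1, q.2, t) := by fun_prop
    exact (continuousAt_height (p := (q.1, q.2, t)) hq.ne').comp
      (f := fun t : ℝ => (q.1, q.2, t)) hc.continuousAt
  · filter_upwards [hlt] with q hq
    exact ae_of_all _ fun t =>
      mul_le_mul' (ENNReal.ofReal_le_ofReal hq.le) (gridAverage_le_two _)
  · simp [ENNReal.mul_eq_top]
  · have hc : Continuous fun q : C(I, ℂ) × ℝ => (q.1, q.2, t) := by fun_prop
    have h₁ : Tendsto (fun q : C(I, ℂ) × ℝ => gridAverage (height t q.2 q.1)) (𝓝 p)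
        (𝓝 (gridAverage (height t p.2 p.1))) :=
      (continuous_gridAverage.tendsto _).comp
        ((continuousAt_height (p := (p.1, p.2, t)) hp.ne').comp
          (f := fun q : C(I, ℂ) × ℝ => (q.1, q.2, t)) hc.continuousAt)
    refine ENNReal.Tendsto.mul ?_ (Or.inl (by simpa using hp)) h₁ (Or.inr ENNReal.ofReal_ne_top)
    exact (ENNReal.continuous_ofReal.comp continuous_snd).continuousAt

lemma directionAverage_le_two (γ : C(I, ℂ)) {μ : ℝ} (hμ : μ ≤ 1) :
    ∫⁻ t in Icc (0 : ℝ) 1, ENNReal.ofReal μ * gridAverage (height t μ γ) ≤ 2 := by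
  refine (setLIntegral_mono (g := fun _ => 1 * 2) measurable_const fun t _ => mul_le_mul' ?_
    (gridAverage_le_two _)).trans (by simp)
  simpa using hμ

lemma totalLength_le_two (γ : C(I, ℂ)) : totalLength γ ≤ 2 :=
  (setLIntegral_mono (g := fun _ => 2) measurable_const
    fun _ hμ => directionAverage_le_two γ hμ.2).trans (by simp)

lemma continuous_totalLength : Continuous totalLength := by
  refine continuous_iff_continuousAt.2 fun γ => ?_
  refine tendsto_lintegral_filter_of_dominated_convergence' (fun _ => 2)
    (Eventually.of_forall fun g => ?_) (Eventually.of_forall fun g => ?_) (by simp) ?_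
  · refine ContinuousOn.aemeasurable (fun μ hμ => ContinuousAt.continuousWithinAt ?_)
      measurableSet_Ioc
    have hc : Continuous fun μ : ℝ => (g, μ) := by fun_prop
    exact (continuousAt_directionAverage (p := (g, μ)) hμ.1).comp
      (f := fun μ : ℝ => (g, μ)) hc.continuousAt
  · filter_upwards [ae_restrict_mem measurableSet_Ioc] with μ hμ
    exact directionAverage_le_two g hμ.2
  · filter_upwards [ae_restrict_mem measurableSet_Ioc] with μ hμ
    have hc : Continuous fun g : C(I, ℂ) => (g, μ) := by fun_prop
    exact (continuousAt_directionAverage (p := (γ, μ)) hμ.1).comp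
      (f := fun g : C(I, ℂ) => (g, μ)) hc.continuousAt

/-! ### Initial segments and reparametrization -/

/-- The map `s ↦ min s τ`. -/
def stopAt (τ : I) : C(I, I) where
  toFun s := min s τ
  continuous_toFun := by fun_prop

/-- Stopping the path at `τ` is a monotone reparametrization, so it keeps the sections of `[0, τ]`.
Dependence on the endpoint thus becomes dependence on a path over all of `[0, 1]`. -/
lemma lintegral_stripLength (γ : C(I, ℂ)) (τ : I) :
    ∫⁻ μ in Ioc (0 : ℝ) 1, ∫⁻ t in Icc (0 : ℝ) 1, ∫⁻ x in Icc (0 : ℝ) 1,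
      stripLength γ (Iic τ) x t μ = totalLength (γ.comp (stopAt τ)) := by
  refine setLIntegral_congr_fun measurableSet_Ioc fun μ hμ => lintegral_congr fun t => ?_
  rw [gridAverage, ← lintegral_const_mul' _ _ ENNReal.ofReal_ne_top]
  refine lintegral_congr fun x => ?_
  rw [stripLength_eq hμ.1]
  congr 1
  have h := sectionSum_comp (l := stopAt τ) (fun a b h => min_le_min_right τ h)
    (stopAt τ).continuous (min_eq_left unitInterval.nonneg') 1 fun s => height t μ γ s - x
  have h1 : stopAt τ 1 = τ := min_eq_right unitInterval.le_one'
  rw [h1] at h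
  exact h.symm

lemma len_Iic (γ : C(I, ℂ)) (τ : I) :
    len γ (Iic τ) = (totalLength (γ.comp (stopAt τ))).toReal := by
  rw [len, lintegral_stripLength]

lemma Iic_one_eq_univ : Iic (1 : I) = univ := eq_univ_of_forall fun _ => unitInterval.le_one'

lemma continuous_len_of_continuous {Y : Type*} [TopologicalSpace Y] {G : Y → C(I, ℂ)} {τ : Y → I}
    (hG : Continuous G) (hτ : Continuous τ) : Continuous fun y => len (G y) (Iic (τ y)) := by
  simp only [len_Iic]
  refine continuous_iff_continuousAt.2 fun y => ?_
  refine (ENNReal.tendsto_toReal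
    (ne_top_of_le_ne_top ENNReal.ofNat_ne_top (totalLength_le_two _))).comp ?_
  refine (continuous_totalLength.comp ?_).continuousAt
  refine ContinuousMap.continuous_of_continuous_uncurry _ ?_
  have : Continuous fun q : Y × I => (G q.1, min q.2 (τ q.1)) := by fun_prop
  have hev : Continuous fun q : C(I, ℂ) × I => q.1 q.2 := by fun_prop
  exact hev.comp this

lemma len_nonneg (γ : I → ℂ) (A : Set I) : 0 ≤ len γ A := ENNReal.toReal_nonneg

lemma len_le_two (γ : C(I, ℂ)) (τ : I) : len γ (Iic τ) ≤ 2 := by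
  rw [len_Iic]
  exact ENNReal.toReal_le_of_le_ofReal (by norm_num) (by simpa using totalLength_le_two _)

lemma len_comp (γ : C(I, ℂ)) (l : C(I, I)) (hl : Monotone l) (h0 : l 0 = 0) (τ : I) :
    len (γ.comp l) (Iic τ) = len γ (Iic (l τ)) := by
  rw [len, len]
  congr 1
  refine setLIntegral_congr_fun measurableSet_Ioc fun μ hμ => lintegral_congr fun t =>
    lintegral_congr fun x => ?_
  rw [stripLength_eq hμ.1, stripLength_eq hμ.1,
    ← sectionSum_comp hl l.continuous h0]
  rfl

lemma len_Iic_zero (γ : C(I, ℂ)) : len γ (Iic 0) = 0 := by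
  rw [len, setLIntegral_congr_fun (g := fun _ => 0) measurableSet_Ioc]
  · simp
  · intro μ hμ
    simp [stripLength_eq (γ := γ) hμ.1, sectionSum_zero]

lemma len_mono (γ : C(I, ℂ)) : Monotone fun τ : I => len γ (Iic τ) := fun a b hab => by
  have : ∫⁻ μ in Ioc (0 : ℝ) 1, ∫⁻ t in Icc (0 : ℝ) 1, ∫⁻ x in Icc (0 : ℝ) 1,
      stripLength γ (Iic b) x t μ ≠ ∞ := by
    rw [lintegral_stripLength]
    exact ne_top_of_le_ne_top ENNReal.ofNat_ne_top (totalLength_le_two _)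
  refine ENNReal.toReal_mono this (setLIntegral_mono' measurableSet_Ioc fun μ hμ =>
    lintegral_mono fun t => lintegral_mono fun x => ?_)
  rw [stripLength_eq hμ.1, stripLength_eq hμ.1]
  exact mul_le_mul_right (sectionSum_mono hab _) _

/-! ### Growth of the length -/

/-- Sections in adjacent strips may share a point, but those in strips of equal parity are disjoint.
Each parity class therefore has at most `N` members. -/
lemma HasSections.card_le {γ : C(I, ℂ)} {ε : ℝ} {N : ℕ}
    (hN : ∀ 𝒥 : Set (Set I), 𝒥.PairwiseDisjoint id →
      (∀ J ∈ 𝒥, J.OrdConnected ∧ ε ≤ Metric.diam (γ '' J)) → 𝒥.encard ≤ N)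
    {τ : I} {n : ℕ} {r x t μ : ℝ} (hμ : 0 < μ) (hε : ε ≤ μ * r)
    (h : HasSections τ n r fun s => height t μ γ s - x) : n + 1 ≤ 2 * N := by
  classical
  obtain ⟨j, u, v, h₁, h₂⟩ := h
  have hdiam : ∀ i, ε ≤ Metric.diam (γ '' Icc (u i) (v i)) := fun i => by
    obtain ⟨a, -, -, d⟩ := h₁ i
    have e : height t μ γ (u i) - x - (height t μ γ (v i) - x) =
        (transverse t (γ (u i)) - transverse t (γ (v i))) / μ := by
      simp only [height_apply]; ring
    rw [e, abs_div, abs_of_pos hμ, le_div_iff₀ hμ, mul_comm] at d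
    refine hε.trans (d.trans ((abs_transverse_sub_le _ _ _).trans ?_))
    exact Metric.dist_le_diam_of_mem (isCompact_Icc.image γ.continuous).isBounded
      (mem_image_of_mem _ (left_mem_Icc.2 a)) (mem_image_of_mem _ (right_mem_Icc.2 a))
  have key : ∀ T : Finset (Fin (n + 1)),
      (∀ i ∈ T, ∀ k ∈ T, (Even (j i) ↔ Even (j k))) → T.card ≤ N := fun T hT => by
    have hdisj : ∀ i ∈ T, ∀ k ∈ T, i ≠ k → Disjoint (Icc (u i) (v i)) (Icc (u k) (v k)) := by
      intro i hi k hk hik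
      rw [Set.disjoint_left]
      intro s hs hs'
      by_cases hj : j i = j k
      · obtain ⟨w, hw | hw, -⟩ := h₂ i k hik hj
        · exact (hw.1.trans hw.2).not_ge (hs'.1.trans hs.2)
        · exact (hw.1.trans hw.2).not_ge (hs.1.trans hs'.2)
      · have a := (h₁ i).2.2.1 s hs.1 hs.2
        have b := (h₁ k).2.2.1 s hs'.1 hs'.2
        have p := hT i hi k hk
        rcases lt_or_gt_of_ne hj with hlt | hlt
        · have : j i + 2 ≤ j k := by
            by_contra! hn
            have e : j k = j i + 1 := by omega
            rw [e, Int.even_add_one] at p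
            tauto
          have : (j i : ℝ) + 2 ≤ j k := by exact_mod_cast this
          linarith [a.2, b.1]
        · have : j k + 2 ≤ j i := by
            by_contra! hn
            have e : j i = j k + 1 := by omega
            rw [e, Int.even_add_one] at p
            tauto
          have : (j k : ℝ) + 2 ≤ j i := by exact_mod_cast this
          linarith [a.1, b.2]
    have hinj : InjOn (fun i => Icc (u i) (v i)) T := by
      intro i hi k hk h
      by_contra hik
      have := hdisj i hi k hk hik
      simp only at h
      rw [h, disjoint_self, bot_eq_empty, Icc_eq_empty_iff] at this
      exact this (h₁ k).1
    have := hN ((fun i => Icc (u i) (v i)) '' T) ?_ ?_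
    · rw [hinj.encard_image, encard_coe_eq_coe_finsetCard] at this
      exact_mod_cast this
    · rintro _ ⟨i, hi, rfl⟩ _ ⟨k, hk, rfl⟩ hne
      exact hdisj i hi k hk fun e => hne (by rw [e])
    · rintro _ ⟨i, hi, rfl⟩
      exact ⟨ordConnected_Icc, hdiam i⟩
  have e₁ := key (Finset.univ.filter fun i => Even (j i)) (fun i hi k hk => by
    simp only [Finset.mem_filter, Finset.mem_univ, true_and] at hi hk; tauto)
  have e₂ := key (Finset.univ.filter fun i => ¬ Even (j i)) (fun i hi k hk => by
    simp only [Finset.mem_filter, Finset.mem_univ, true_and] at hi hk; tauto)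
  have e₃ := Finset.card_filter_add_card_filter_not (s := (Finset.univ : Finset (Fin (n + 1))))
    fun i => Even (j i)
  rw [Finset.card_univ, Fintype.card_fin] at e₃
  omega

/-- A further traversal of a strip increases the weighted sum by a definite amount, depending only
on the number of large sections. -/
lemma sectionSum_add_le {f : I → ℝ} (hf : Continuous f) {a b : I} (hab : a ≤ b)
    (h : 3 ≤ |f b - f a|) {M : ℕ} (hM : ∀ r : ℝ, 1 / 2 ≤ r → ¬ HasSections a M r f) :
    sectionSum a f + 1 / 2 / 2 ^ M / 2 ≤ sectionSum b f := by
  obtain ⟨j, u, v, ha, hau, huv, hvb, H, hd⟩ := exists_section_of_three_le hf hab h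
  have h0 : 1 ≤ sectionWidth b 0 f := by
    have := (hasSections_zero_of_section (r := (1 : ℝ≥0)) huv hvb H
      (by rw [hd]; simp)).le_sectionWidth
    simpa using this
  have hsucc : ∀ n, sectionWidth a n f ≤ sectionWidth b (n + 1) f := fun n =>
    iSup₂_le fun r hr => (hr.insert ha hau huv hvb H (by rw [hd]; exact hr.le_one)).le_sectionWidth
  -- The new section has the maximal width 1 and takes rank 0; every old width moves down one rank,
  -- so its weight is halved.
  have hlow : 1 + sectionSum a f / 2 ≤ sectionSum b f := by
    rw [sectionSum, sectionSum, tsum_eq_zero_add' (f := fun n => sectionWidth b n f / 2 ^ n)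
      ENNReal.summable, div_eq_mul_inv _ (2 : ℝ≥0∞), ← ENNReal.tsum_mul_right]
    refine add_le_add (by simpa using h0) (ENNReal.tsum_le_tsum fun n => ?_)
    rw [pow_succ, div_eq_mul_inv, div_eq_mul_inv,
      ENNReal.mul_inv (Or.inr ENNReal.ofNat_ne_top) (Or.inr two_ne_zero), ← mul_assoc]
    gcongr
    exact hsucc n
  -- All widths are at most 1, and that of rank `M` at most 1/2, so the sum stays away from its
  -- maximum 2.
  have hhigh : sectionSum a f + 1 / 2 / 2 ^ M ≤ 2 := by
    have e : ∑' n : ℕ, (if n = M then (1 : ℝ≥0∞) / 2 else 0) / 2 ^ n = 1 / 2 / 2 ^ M := by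
      rw [tsum_eq_single M fun n hn => by simp [hn]]
      simp
    rw [← e, sectionSum, ← ENNReal.tsum_add]
    refine le_trans ?_ tsum_one_div_two_pow.le
    refine ENNReal.tsum_le_tsum fun n => ?_
    rw [← ENNReal.add_div]
    refine ENNReal.div_le_div_right ?_ _
    split_ifs with hn
    · subst hn
      have : sectionWidth a n f ≤ 1 / 2 := iSup₂_le fun r hr => by
        by_contra! hlt
        refine hM r ?_ hr
        have : ((1 / 2 : ℝ≥0) : ℝ≥0∞) < r := by simpa using hlt
        have h' : (1 / 2 : ℝ≥0) < r := by exact_mod_cast this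
        exact_mod_cast h'.le
      exact (add_le_add_left this _).trans (ENNReal.add_halves 1).le
    · simpa using sectionWidth_le_one a n f
  calc sectionSum a f + 1 / 2 / 2 ^ M / 2
      = (sectionSum a f + 1 / 2 / 2 ^ M) / 2 + sectionSum a f / 2 := by
        rw [ENNReal.add_div, add_right_comm, ENNReal.add_halves]
    _ ≤ 2 / 2 + sectionSum a f / 2 := by gcongr
    _ = 1 + sectionSum a f / 2 := by
        rw [ENNReal.div_self two_ne_zero ENNReal.ofNat_ne_top]
    _ ≤ _ := hlow

/-- In a definite proportion of the directions, a vector has a large transverse coordinate. -/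
lemma volume_transverse_ge {z w : ℂ} {ε : ℝ} (hε : 0 < ε) (hzw : ε ≤ dist z w) :
    ENNReal.ofReal (1 / 4) ≤
      volume ({t : ℝ | ε / 2 ≤ |transverse t z - transverse t w|} ∩ Icc 0 1) := by
  set T := {t : ℝ | ε / 2 ≤ |transverse t z - transverse t w|} ∩ Icc 0 1 with hT
  -- The directions `t` and `t + 1/2` are perpendicular, so the two coordinate differences cannot
  -- both be below `ε / 2`. Hence the good set and its translate by 1/2 cover `[0, 1/2]`.
  have hsq : ∀ t : ℝ, (transverse t z - transverse t w) ^ 2 +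
      (transverse (t + 1 / 2) z - transverse (t + 1 / 2) w) ^ 2 = dist z w ^ 2 := fun t => by
    have e : ∀ t : ℝ, transverse t z - transverse t w =
        (Complex.exp (-(t * Real.pi * Complex.I)) * (z - w)).im := fun t => by
      rw [transverse, transverse, mul_sub, Complex.sub_im]
    have e' : Complex.exp (-(((t + 1 / 2 : ℝ) : ℂ) * Real.pi * Complex.I)) =
        -Complex.I * Complex.exp (-(t * Real.pi * Complex.I)) := by
      have : -(((t + 1 / 2 : ℝ) : ℂ) * Real.pi * Complex.I) =
          -(t * Real.pi * Complex.I) + -(Real.pi / 2 * Complex.I) := by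
        push_cast; ring
      rw [this, Complex.exp_add, Complex.exp_neg (Real.pi / 2 * Complex.I),
        Complex.exp_pi_div_two_mul_I, Complex.inv_I]
      ring
    rw [e, e, e', mul_assoc (-Complex.I)]
    obtain ⟨y, hy⟩ : ∃ y, y = Complex.exp (-(t * Real.pi * Complex.I)) * (z - w) := ⟨_, rfl⟩
    rw [← hy]
    have hn : ‖y‖ = dist z w := by
      have hn := Complex.norm_exp_ofReal_mul_I (-(t * Real.pi))
      push_cast at hn
      rw [hy, norm_mul, ← neg_mul, hn, one_mul, dist_eq_norm]
    rw [← hn, Complex.sq_norm, Complex.normSq_apply]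
    simp
    ring
  have hcover : Icc (0 : ℝ) (1 / 2) ⊆ T ∪ (fun t => t + 1 / 2) ⁻¹' T := fun t ht => by
    by_contra hn
    have hn' : t ∉ T ∧ t + 1 / 2 ∉ T := by simpa [not_or] using hn
    have h₁ : |transverse t z - transverse t w| < ε / 2 := by
      by_contra! h
      exact hn'.1 ⟨h, ht.1, by linarith [ht.2]⟩
    have h₂ : |transverse (t + 1 / 2) z - transverse (t + 1 / 2) w| < ε / 2 := by
      by_contra! h
      exact hn'.2 ⟨h, by linarith [ht.1], by linarith [ht.2]⟩
    have h₃ := sq_lt_sq' (neg_lt_of_abs_lt h₁) (lt_of_abs_lt h₁)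
    have h₄ := sq_lt_sq' (neg_lt_of_abs_lt h₂) (lt_of_abs_lt h₂)
    nlinarith [hsq t]
  have hv : ENNReal.ofReal (1 / 2) ≤ volume T + volume T := by
    have h := (measure_mono hcover).trans (measure_union_le (μ := volume) _ _)
    rw [measure_preimage_add_right, Real.volume_Icc] at h
    simpa using h
  by_contra! hlt
  refine hv.not_gt ((ENNReal.add_lt_add hlt hlt).trans_eq ?_)
  rw [← ENNReal.ofReal_add (by norm_num) (by norm_num)]
  norm_num

/-- Only the added indicator has to be measurable, so the iterated integrals can be compared without
measurability of `f` or `g`. -/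
lemma setLIntegral_add_mul_le {A S : Set ℝ} (hA : MeasurableSet A) (hS : MeasurableSet S)
    {f g : ℝ → ℝ≥0∞} {C : ℝ≥0∞} (h : ∀ x ∈ A, f x ≤ g x)
    (h' : ∀ x ∈ A, x ∈ S → f x + C ≤ g x) :
    (∫⁻ x in A, f x) + C * volume (S ∩ A) ≤ ∫⁻ x in A, g x := by
  rw [← Measure.restrict_apply hS, ← lintegral_indicator_const hS,
    ← lintegral_add_right _ (measurable_const.indicator hS)]
  refine setLIntegral_mono' hA fun x hx => ?_
  by_cases hxS : x ∈ S
  · rw [indicator_of_mem hxS]; exact h' x hx hxS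
  · rw [indicator_of_notMem hxS, add_zero]; exact h x hx

/-- If the paths of a family have few long sections, then between two parameters whose images are
not close the length grows by a definite amount. -/
lemma FewLongSections.exists_gap {F : Set C(I, ℂ)} (hF : FewLongSections F) {ε : ℝ} (hε : 0 < ε) :
    ∃ δ : ℝ, 0 < δ ∧ ∀ γ ∈ F, ∀ a b : I, a ≤ b → ε ≤ dist (γ a) (γ b) →
      len γ (Iic a) + δ ≤ len γ (Iic b) := by
  -- For `μ ≤ m ≤ ε / 6`, a transverse difference of `ε / 2` is at least three strip widths. For `μ
  -- ≥ m / 2`, a section of relative width 1/2 has diameter at least `m / 4`, the threshold used for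
  -- `N`.
  obtain ⟨m, hm0, hm1, hmε⟩ : ∃ m : ℝ, 0 < m ∧ m ≤ 1 ∧ m ≤ ε / 6 :=
    ⟨min 1 (ε / 6), by positivity, min_le_left _ _, min_le_right _ _⟩
  obtain ⟨N, -, hN⟩ := hF (m / 4) (by positivity)
  obtain ⟨c, hc⟩ : ∃ c : ℝ≥0∞, c = 1 / 2 / 2 ^ (2 * N) / 2 := ⟨_, rfl⟩
  have hc0 : c ≠ 0 := by simp [hc, ENNReal.div_eq_zero_iff]
  have hcT : c ≠ ∞ := by simp [hc, ENNReal.div_eq_top]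
  -- The factors are the least `μ`, the gain in the weighted sum, the measure of the good directions
  -- and the length of the interval of scales.
  obtain ⟨D, hD⟩ : ∃ D : ℝ≥0∞,
    D = ENNReal.ofReal (m / 2) * c * ENNReal.ofReal (1 / 4) * ENNReal.ofReal (m / 2) := ⟨_, rfl⟩
  have hD0 : D ≠ 0 := by simp [hD, hc0, hm0]
  have hDT : D ≠ ∞ := by simp [hD, ENNReal.mul_eq_top, hcT]
  refine ⟨D.toReal, ENNReal.toReal_pos hD0 hDT, fun γ hγ a b hab hdist => ?_⟩
  obtain ⟨T, hT⟩ : ∃ T : Set ℝ, T = {t : ℝ | ε / 2 ≤ |transverse t (γ a) - transverse t (γ b)|} :=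
    ⟨_, rfl⟩
  have hTm : MeasurableSet T := by
    have hcont : ∀ z : ℂ, Continuous fun t : ℝ => transverse t z := fun z => by
      unfold transverse; fun_prop
    exact hT ▸ (isClosed_le continuous_const ((hcont _).sub (hcont _)).abs).measurableSet
  have hTv : ENNReal.ofReal (1 / 4) ≤ volume (T ∩ Icc 0 1) := hT ▸ volume_transverse_ge hε hdist
  have mono : ∀ μ ∈ Ioc (0 : ℝ) 1, ∀ t x : ℝ,
      stripLength γ (Iic a) x t μ ≤ stripLength γ (Iic b) x t μ := fun μ hμ t x => by
    rw [stripLength_eq hμ.1, stripLength_eq hμ.1]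
    exact mul_le_mul_right (sectionSum_mono hab _) _
  have point : ∀ μ ∈ Ioc (0 : ℝ) 1, μ ∈ Icc (m / 2) m → ∀ t ∈ T, ∀ x : ℝ,
      stripLength γ (Iic a) x t μ + ENNReal.ofReal (m / 2) * c ≤ stripLength γ (Iic b) x t μ := by
    intro μ hμ hμm t ht x
    rw [stripLength_eq hμ.1, stripLength_eq hμ.1]
    have hcont : Continuous fun s => height t μ γ s - x :=
      (height t μ γ).continuous.sub continuous_const
    have h3 : 3 ≤ |height t μ γ b - x - (height t μ γ a - x)| := by
      have e : height t μ γ b - x - (height t μ γ a - x) =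
          -((transverse t (γ a) - transverse t (γ b)) / μ) := by
        simp only [height_apply]; ring
      rw [e, abs_neg, abs_div, abs_of_pos hμ.1, le_div_iff₀ hμ.1]
      have ht' : ε / 2 ≤ |transverse t (γ a) - transverse t (γ b)| := by rwa [hT] at ht
      linarith [hμm.2]
    have := sectionSum_add_le hcont hab h3 (M := 2 * N) fun r hr hs => by
      have hle := hs.card_le (hN γ hγ) hμ.1 (by nlinarith [hμm.1])
      omega
    rw [← hc] at this
    refine le_trans ?_ (mul_le_mul_right this _)
    rw [mul_add]
    gcongr
    exact hμm.1
  have hint : totalLength (γ.comp (stopAt a)) + D ≤ totalLength (γ.comp (stopAt b)) := by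
    rw [← lintegral_stripLength, ← lintegral_stripLength]
    have hx : ∀ μ ∈ Ioc (0 : ℝ) 1, μ ∈ Icc (m / 2) m → ∀ t ∈ T,
        (∫⁻ x in Icc (0 : ℝ) 1, stripLength γ (Iic a) x t μ) + ENNReal.ofReal (m / 2) * c ≤
        ∫⁻ x in Icc (0 : ℝ) 1, stripLength γ (Iic b) x t μ := fun μ hμ hμm t ht => by
      simpa using setLIntegral_add_mul_le (measurableSet_Icc (a := (0 : ℝ)) (b := 1))
        MeasurableSet.univ
        (fun x _ => mono μ hμ t x) fun x _ _ => point μ hμ hμm t ht x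
    have ht : ∀ μ ∈ Ioc (0 : ℝ) 1, μ ∈ Icc (m / 2) m →
        (∫⁻ t in Icc (0 : ℝ) 1, ∫⁻ x in Icc (0 : ℝ) 1, stripLength γ (Iic a) x t μ) +
          ENNReal.ofReal (m / 2) * c * ENNReal.ofReal (1 / 4) ≤
        ∫⁻ t in Icc (0 : ℝ) 1, ∫⁻ x in Icc (0 : ℝ) 1, stripLength γ (Iic b) x t μ :=
      fun μ hμ hμm => by
        refine le_trans ?_ (setLIntegral_add_mul_le measurableSet_Icc hTm
          (fun t _ => lintegral_mono fun x => mono μ hμ t x) fun t _ => hx μ hμ hμm t)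
        gcongr
    have hμ := setLIntegral_add_mul_le measurableSet_Ioc
      (measurableSet_Icc (a := m / 2) (b := m))
      (fun μ hμ => lintegral_mono fun t => lintegral_mono fun x => mono μ hμ t x) ht
    have hsub : Icc (m / 2) m ⊆ Ioc 0 1 := fun μ hμ =>
      ⟨(half_pos hm0).trans_le hμ.1, hμ.2.trans hm1⟩
    rwa [inter_eq_left.2 hsub, Real.volume_Icc, sub_half, ← hD] at hμ
  have hfin : ∀ γ : C(I, ℂ), totalLength γ ≠ ∞ := fun γ =>
    ne_top_of_le_ne_top ENNReal.ofNat_ne_top (totalLength_le_two γ)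
  rw [len_Iic, len_Iic, ← ENNReal.toReal_add (hfin _) hDT]
  exact ENNReal.toReal_mono (hfin _) hint

/-! ### Equicontinuity implies few long sections -/

/-- An interval with a large image contains two points at least `δ` apart, hence a point of a grid
of mesh below `δ`. Disjoint intervals use different grid points. -/
lemma fewLongSections_of_equicontinuous {F : Set C(I, ℂ)}
    (hF : Equicontinuous fun γ : F => (γ.1 : I → ℂ)) : FewLongSections F := by
  intro ε hε
  have hu := CompactSpace.uniformEquicontinuous_of_equicontinuous hF
  obtain ⟨δ, hδ, H⟩ := Metric.uniformEquicontinuous_iff.1 hu (ε / 2) (by positivity)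
  obtain ⟨n, hn⟩ := exists_nat_one_div_lt hδ
  refine ⟨n + 2, by omega, fun γ hγ 𝒥 hdisj h𝒥 => ?_⟩
  have hn0 : (0 : ℝ) < n + 1 := by positivity
  have hgrid : ∀ J ∈ 𝒥, ∃ k : Fin (n + 2), ∃ hk : ((k : ℕ) : ℝ) / (n + 1) ∈ I,
      (⟨_, hk⟩ : I) ∈ J := by
    intro J hJ
    obtain ⟨hJc, hJd⟩ := h𝒥 J hJ
    obtain ⟨a, ha, b, hb, hab, hfar⟩ : ∃ a ∈ J, ∃ b ∈ J, a ≤ b ∧ δ ≤ dist a b := by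
      by_contra! hclose
      have : Metric.diam (γ '' J) ≤ ε / 2 := by
        refine Metric.diam_le_of_forall_dist_le (by positivity) ?_
        rintro _ ⟨a, ha, rfl⟩ _ ⟨b, hb, rfl⟩
        refine (H a b ?_ ⟨γ, hγ⟩).le
        rcases le_total a b with h | h
        · exact hclose a ha b hb h
        · rw [dist_comm]; exact hclose b hb a ha h
      linarith
    have hd : (a : ℝ) + δ ≤ b := by
      rw [Subtype.dist_eq, Real.dist_eq, abs_sub_comm, abs_of_nonneg
        (sub_nonneg.2 (by exact_mod_cast hab))] at hfar
      linarith
    have h₁ : (a : ℝ) ≤ ⌈(a : ℝ) * (n + 1)⌉₊ / (n + 1) := by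
      rw [le_div_iff₀ hn0]; exact Nat.le_ceil _
    have h₂ : (⌈(a : ℝ) * (n + 1)⌉₊ : ℝ) / (n + 1) ≤ b := by
      have := Nat.ceil_lt_add_one (mul_nonneg a.2.1 hn0.le)
      rw [div_lt_iff₀ hn0] at hn
      rw [div_le_iff₀ hn0]
      nlinarith
    have hk : ⌈(a : ℝ) * (n + 1)⌉₊ < n + 2 := by
      have : (⌈(a : ℝ) * (n + 1)⌉₊ : ℝ) ≤ n + 1 := by
        rw [div_le_iff₀ hn0] at h₂
        nlinarith [b.2.2]
      have : ⌈(a : ℝ) * (n + 1)⌉₊ ≤ n + 1 := by exact_mod_cast this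
      omega
    exact ⟨⟨_, hk⟩, ⟨a.2.1.trans h₁, h₂.trans b.2.2⟩, hJc.out ha hb ⟨h₁, h₂⟩⟩
  choose! k hk hkJ using hgrid
  have hinj : InjOn k 𝒥 := by
    intro J hJ J' hJ' h
    by_contra hne
    refine disjoint_left.1 (hdisj hJ hJ' hne) (hkJ J hJ) ?_
    have := hkJ J' hJ'
    simp only [h]
    exact this
  rw [← hinj.encard_image]
  refine (encard_le_encard (subset_univ _)).trans ?_
  rw [encard_univ, ENat.card_eq_coe_fintype_card, Fintype.card_fin]

/-! ### The standard representation -/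

/-- A single path is an equicontinuous family, so the growth estimate applies to it. -/
lemma eq_of_len_eq (γ : C(I, ℂ)) {a b : I} (h : len γ (Iic a) = len γ (Iic b)) : γ a = γ b := by
  wlog hab : a ≤ b generalizing a b
  · exact (this h.symm (le_of_not_ge hab)).symm
  by_contra hne
  have hF : FewLongSections {γ} := fewLongSections_of_equicontinuous
    (equicontinuous_finite.2 fun γ => γ.1.continuous)
  obtain ⟨δ, hδ, H⟩ := hF.exists_gap (dist_pos.2 hne)
  linarith [H γ rfl a b hab le_rfl]

lemma len_Iic_le_univ (γ : C(I, ℂ)) (τ : I) : len γ (Iic τ) ≤ len γ univ :=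
  Iic_one_eq_univ ▸ len_mono γ unitInterval.le_one'

/-- The normalized length of the initial segments of `γ`. -/
noncomputable def lenRatio (γ : C(I, ℂ)) : C(I, I) where
  toFun τ := ⟨len γ (Iic τ) / len γ univ, div_nonneg (len_nonneg _ _) (len_nonneg _ _),
    div_le_one_of_le₀ (len_Iic_le_univ γ τ) (len_nonneg _ _)⟩
  continuous_toFun :=
    ((continuous_len_of_continuous continuous_const continuous_id).div_const _).subtype_mk _

lemma lenRatio_mul {γ : C(I, ℂ)} (h : len γ univ ≠ 0) (τ : I) :
    (lenRatio γ τ : ℝ) * len γ univ = len γ (Iic τ) := div_mul_cancel₀ _ h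

lemma monotone_lenRatio (γ : C(I, ℂ)) : Monotone (lenRatio γ) := fun _ _ hab =>
  Subtype.coe_le_coe.1 (div_le_div_of_nonneg_right (len_mono γ hab) (len_nonneg _ _))

lemma lenRatio_zero (γ : C(I, ℂ)) : lenRatio γ 0 = 0 :=
  Subtype.ext (by change len γ (Iic 0) / len γ univ = 0; rw [len_Iic_zero, zero_div])

lemma lenRatio_surjective {γ : C(I, ℂ)} (h : len γ univ ≠ 0) :
    Function.Surjective (lenRatio γ) := by
  have h1 : lenRatio γ 1 = 1 := Subtype.ext (by
    change len γ (Iic 1) / len γ univ = 1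
    rw [Iic_one_eq_univ, div_self h])
  intro s
  obtain ⟨τ, -, hτ⟩ := intermediate_value_Icc (zero_le_one (α := I))
    (lenRatio γ).continuous.continuousOn
    (show s ∈ Icc (lenRatio γ 0) (lenRatio γ 1) by
      rw [lenRatio_zero, h1]; exact ⟨unitInterval.nonneg', unitInterval.le_one'⟩)
  exact ⟨τ, hτ⟩

lemma len_Iic_of_len_eq_zero {γ : C(I, ℂ)} (h : len γ univ = 0) (τ : I) : len γ (Iic τ) = 0 :=
  le_antisymm (h ▸ len_Iic_le_univ γ τ) (len_nonneg _ _)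

lemma exists_isStandardRep (γ : C(I, ℂ)) : ∃ g : C(I, ℂ), IsStandardRep γ g := by
  by_cases h : len γ univ = 0
  -- A path of length zero is constant and represents itself.
  · refine ⟨γ, fun s => ⟨⟨0, by rw [h, mul_zero, len_Iic_zero]⟩, fun t _ => eq_of_len_eq γ ?_⟩⟩
    rw [len_Iic_of_len_eq_zero h, len_Iic_of_len_eq_zero h]
  -- A continuous surjection of the compact interval onto itself is a quotient map, so the induced
  -- path is automatically continuous.
  · have hq : Topology.IsQuotientMap (lenRatio γ) :=
      Topology.IsQuotientMap.of_surjective_continuous (lenRatio_surjective h) (lenRatio γ).continuous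
    have hfac : Function.FactorsThrough γ (lenRatio γ) := fun a b hab => eq_of_len_eq γ (by
      rw [← lenRatio_mul h, ← lenRatio_mul h, hab])
    have hg : ∀ t, hq.lift γ hfac (lenRatio γ t) = γ t := fun t =>
      DFunLike.congr_fun (hq.lift_comp γ hfac) t
    refine ⟨hq.lift γ hfac, fun s => ⟨?_, fun t ht => ?_⟩⟩
    · obtain ⟨t, rfl⟩ := lenRatio_surjective h s
      exact ⟨t, (lenRatio_mul h t).symm⟩
    · rw [← hg t]
      congr 1
      rw [← lenRatio_mul h] at ht
      exact Subtype.ext (mul_right_cancel₀ h ht).symm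

lemma IsStandardRep.unique {γ g g' : C(I, ℂ)} (h : IsStandardRep γ g) (h' : IsStandardRep γ g') :
    g = g' := by
  ext s
  obtain ⟨t, ht⟩ := (h s).1
  rw [(h s).2 t ht, (h' s).2 t ht]

/-- Initial segments of a standard representation have length proportional to the parameter. -/
lemma IsStandardRep.len_Iic_eq {γ g : C(I, ℂ)} (h : IsStandardRep γ g) (s : I) :
    len g (Iic s) = s * len g univ := by
  by_cases h0 : len γ univ = 0
  · have hconst : ∀ s, g s = γ 0 := fun s => (h s).2 0 (by rw [h0, mul_zero, len_Iic_zero])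
    have hg : g = g.comp (ContinuousMap.const I 0) := by
      ext s; simp [hconst]
    have hlen : ∀ s, len g (Iic s) = 0 := fun s => by
      rw [hg, len_comp g _ (fun _ _ _ => le_rfl) rfl]
      exact len_Iic_zero g
    rw [hlen, ← Iic_one_eq_univ, hlen, mul_zero]
  -- The path is a monotone reparametrization of its representation, so both have the same lengths
  -- of initial segments.
  · have hγ : γ = g.comp (lenRatio γ) := by
      ext t
      exact ((h (lenRatio γ t)).2 t (lenRatio_mul h0 t).symm).symm
    have key : ∀ s, len g (Iic s) = s * len γ univ := fun s => by
      obtain ⟨t, rfl⟩ := lenRatio_surjective h0 s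
      rw [← len_comp g _ (monotone_lenRatio γ) (lenRatio_zero γ), ← hγ, lenRatio_mul h0]
    have h1 := key 1
    rw [Iic_one_eq_univ, Icc.coe_one, one_mul] at h1
    rw [key, h1]

lemma isStandardRep_self {g : C(I, ℂ)} (h : ∀ s : I, len g (Iic s) = s * len g univ) :
    IsStandardRep g g := fun s =>
  ⟨⟨s, h s⟩, fun t ht => eq_of_len_eq g (by rw [ht, h])⟩

/-! ### Equicontinuity and limits of standard representations -/

/-- Lengths never exceed 2, so parameters within `δ / 2` correspond to lengths differing by less
than `δ`; the growth estimate then forces the points to be close. -/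
lemma equicontinuous_standardReps {F : Set C(I, ℂ)} (hF : FewLongSections F) :
    Equicontinuous fun g : standardReps F => (g.1 : I → ℂ) := by
  refine UniformEquicontinuous.equicontinuous ?_
  rw [Metric.uniformEquicontinuous_iff]
  intro ε hε
  obtain ⟨δ, hδ, H⟩ := hF.exists_gap hε
  refine ⟨δ / 2, by positivity, fun s s' hs ⟨g, γ, hγ, hg⟩ => ?_⟩
  wlog hle : s ≤ s' generalizing s s'
  · rw [dist_comm]
    exact this s' s (by rwa [dist_comm]) (le_of_not_ge hle)
  by_contra! hfar
  obtain ⟨t, ht⟩ := (hg s).1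
  obtain ⟨t', ht'⟩ := (hg s').1
  simp only [(hg s).2 t ht, (hg s').2 t' ht'] at hfar
  have hlen : len γ univ ≤ 2 := Iic_one_eq_univ ▸ len_le_two γ 1
  have hss : (s : ℝ) ≤ s' := hle
  rw [Subtype.dist_eq, Real.dist_eq, abs_sub_comm, abs_of_nonneg (sub_nonneg.2 hss)] at hs
  have hpos := len_nonneg γ univ
  rcases le_total t t' with htt | htt
  · have := H γ hγ t t' htt hfar
    rw [ht, ht'] at this
    nlinarith
  · have := H γ hγ t' t htt (by rwa [dist_comm])
    rw [ht, ht'] at this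
    nlinarith

/-- Proportionality of length to parameter is a family of closed conditions on the path, since
length is continuous. -/
lemma isStandardRep_self_of_tendsto {g : ℕ → C(I, ℂ)} {g' : C(I, ℂ)}
    (hg : ∀ m, ∃ γ, IsStandardRep γ (g m)) (h : Tendsto g atTop (𝓝 g')) : IsStandardRep g' g' := by
  have hc : ∀ s : I, Tendsto (fun m => len (g m) (Iic s)) atTop (𝓝 (len g' (Iic s))) := fun s =>
    ((continuous_len_of_continuous (continuous_id (X := C(I, ℂ)))
      (continuous_const (y := s))).tendsto g').comp h
  refine isStandardRep_self fun s => tendsto_nhds_unique (hc s) ?_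
  have h1 := hc 1
  rw [Iic_one_eq_univ] at h1
  refine (h1.const_mul (s : ℝ)).congr fun m => ?_
  obtain ⟨γ, hγ⟩ := hg m
  exact (hγ.len_Iic_eq s).symm

lemma exists_subseq_tendsto {F : Set C(I, ℂ)} (hF : FewLongSections F) {K : Set ℂ}
    (hK : IsCompact K) (hFK : ∀ γ ∈ F, ∀ t : I, γ t ∈ K) {g : ℕ → C(I, ℂ)}
    (hg : ∀ m, g m ∈ standardReps F) :
    ∃ φ : ℕ → ℕ, StrictMono φ ∧ ∃ g' : C(I, ℂ), (∀ s, g' s ∈ K) ∧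
      Tendsto (g ∘ φ) atTop (𝓝 g') := by
  have hmem : ∀ f ∈ standardReps F, ∀ s, f s ∈ K := by
    rintro f ⟨γ, hγ, hf⟩ s
    obtain ⟨t, ht⟩ := (hf s).1
    rw [(hf s).2 t ht]
    exact hFK γ hγ t
  let e := ContinuousMap.equivBoundedOfCompact I ℂ
  have hcomp : IsCompact (closure (e '' standardReps F)) := by
    refine BoundedContinuousFunction.arzela_ascoli K hK _ ?_ ?_
    · rintro _ s ⟨f, hf, rfl⟩
      exact hmem f hf s
    · intro s U hU
      filter_upwards [equicontinuous_standardReps hF s U hU] with x hx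
      rintro ⟨_, f, hf, rfl⟩
      exact hx ⟨f, hf⟩
  obtain ⟨b, -, φ, hφ, hlim⟩ := hcomp.tendsto_subseq (x := fun m => e (g m))
    fun m => subset_closure (mem_image_of_mem _ (hg m))
  refine ⟨φ, hφ, e.symm b, fun s => ?_, ?_⟩
  · have hev : Continuous fun f : BoundedContinuousFunction I ℂ => f s := by fun_prop
    refine hK.isClosed.mem_of_tendsto ((hev.tendsto b).comp hlim)
      (Eventually.of_forall fun m => hmem _ (hg _) s)
  · exact ((ContinuousMap.isometryEquivBoundedOfCompact I ℂ).symm.continuous.tendsto b).comp hlim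

end PathLength

theorem theorem9 (F : Set C(unitInterval, ℂ)) :
    (∀ γ : C(unitInterval, ℂ), ∃! g : C(unitInterval, ℂ), PathLength.IsStandardRep γ g) ∧
    (PathLength.FewLongSections F →
      Equicontinuous (fun (g : PathLength.standardReps F) => (g.1 : unitInterval → ℂ)) ∧
      ∀ K : Set ℂ, IsCompact K → (∀ γ ∈ F, ∀ t : unitInterval, γ t ∈ K) →
        ∀ g : ℕ → C(unitInterval, ℂ), (∀ m, g m ∈ PathLength.standardReps F) →
          ∃ φ : ℕ → ℕ, StrictMono φ ∧ ∃ g' : C(unitInterval, ℂ), (∀ s, g' s ∈ K) ∧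
            TendstoUniformly (fun k => (g (φ k) : unitInterval → ℂ)) g' Filter.atTop ∧
            PathLength.IsStandardRep g' g') ∧
    (Equicontinuous (fun (γ : F) => (γ.1 : unitInterval → ℂ)) → PathLength.FewLongSections F) := by
  refine ⟨fun γ => ?_, fun hF => ⟨PathLength.equicontinuous_standardReps hF, ?_⟩,
    PathLength.fewLongSections_of_equicontinuous⟩
  · obtain ⟨g, hg⟩ := PathLength.exists_isStandardRep γ
    exact ⟨g, hg, fun g' hg' => hg'.unique hg⟩
  · intro K hK hFK g hg
    obtain ⟨φ, hφ, g', hg', hlim⟩ := PathLength.exists_subseq_tendsto hF hK hFK hg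
    refine ⟨φ, hφ, g', hg', ContinuousMap.tendsto_iff_tendstoUniformly.1 hlim,
      PathLength.isStandardRep_self_of_tendsto (fun m => ?_) hlim⟩
    obtain ⟨γ, -, hγ⟩ := hg (φ m)
    exact ⟨γ, hγ⟩
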